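/- Let $S^1=\mathbb R/\mathbb Z$, $Z=S^1\times\mathbb R$, $T^2=S^1\times S^1$, $TT^2=T^2\times\mathbb R^2$. Let $D>0$ and $D_\pm\in\mathbb R$, and let $H=H(t,x,y)$ be a $C^\infty$ function on $S^1\times S^1\times\mathbb R$ (a time-periodic Hamiltonian on $S^1$) with $\partial_{yy}H>0$, $H=\tfrac12y^2+D_+$ for $y>D$ and $H=\tfrac12y^2+D_-$ for $y<-D$. Let $\hat f:Z\to Z$ be a map (for instance a twist map) generated by $H$: it is the time-1 map, from time $0$ to time $1$, of the flow of $\dot x=\partial_yH$, $\dot y=-\partial_xH$. Let $\hat L(t,x,v)=\sup_y\,(yv-H(t,x,y))$ be the Lagrangian associated with $H$. Let $A,B>0$ and let $h_\pm:\mathbb R\to\mathbb R$ be $C^\infty$ functions with $h_\pm''>0$, $h_+(y)=\tfrac12y^2-D_+$ for $y<D+1$, $h_+(y)=\sqrt{A+By^2}$ for $y>D+2$, $h_-(y)=\tfrac12y^2-D_-$ for $y>-D-1$, $h_-(y)=\sqrt{A+By^2}$ for $y<-D-2$. Put $$L(t,x,y)=\begin{cases}h_-(y)&y<-D\\ \hat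 L(t,x,y)&-D\le y\le D\\ h_+(y)&y>D\end{cases}\qquad F(t,x,v_1,v_2)=\begin{cases}v_1L(t,x,v_2/v_1)&v_1>0\\ \sqrt{Av_1^2+Bv_2^2}&v_1\le0.\end{cases}$$ Then $F$ is a $C^\infty$ Finsler metric on $T^2$ (smooth off the zero section, positively homogeneous, with $\partial_{v_iv_j}\tfrac12F^2$ positive definite for $v\ne0$), and its geodesic flow, the Euler–Lagrange flow of $\tfrac12F^2$ on $ST^2=F^{-1}(1)$, is defined for all times. Every point of $V_0=\{(0,h,v)\in ST^2: h\in S^1,\ v_1>0\}$ returns to $V_0$ under the geodesic flow, so the first return map $R:V_0\to V_0$ is well defined, and $R$ is conjugated via a diffeomorphism to $\hat f$. More precisely: 1. $g:V_0\to Z$, $g(0,h,v_1,v_2)=(h,v_2/v_1)$, is a diffeomorphism, and $g\circ R=E\circ g$, where $E:Z\to Z$ is the time-1 map, in coordinates (position, velocity), of the Euler–Lagrange flow of $L$. 2. There is a diffeomorphism $\Phi:V_0\to Z$ with $\Phi\circ R=\hat f\circ\Phi$ and $\mathcal L_0\circ\Phi=g$, where $\mathcal L_0(x,y)=(x,\partial_yH(0,x,y))$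 is the Legendre transformation at time $0$, which passes from momentum to velocity. (So $\Phi=g$ if $\mathcal L_0=\mathrm{id}$.) -/

import Mathlib

open Set Filter Topology
open scoped ContDiff

noncomputable section

namespace FinslerTwist

/-! ### The circle, the cylinder, the torus and its tangent bundle -/

/-- The circle `ℝ / ℤ`. -/
abbrev S1 := AddCircle (1 : ℝ)

/-- The cylinder `S¹ × ℝ`. -/
abbrev Cyl := S1 × ℝ

/-- The 2-torus; its points are written `(t, x)`. -/
abbrev T2 := S1 × S1

/-- The tangent bundle of the 2-torus, trivialised as `T² × ℝ²`. -/
abbrev TT2 := T2 × (ℝ × ℝ)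

/-- The universal covering of the torus. -/
def projT (q : ℝ × ℝ) : T2 := ((q.1 : S1), (q.2 : S1))

/-- The universal covering of the tangent bundle of the torus. -/
def projTT (w : (ℝ × ℝ) × (ℝ × ℝ)) : TT2 := (projT w.1, w.2)

/-- The universal covering of the cylinder. -/
def projZ (q : ℝ × ℝ) : Cyl := ((q.1 : S1), q.2)

/-- Smoothness on an arbitrary subset `S` of a manifold `X`: near every point of `S` the map is the
restriction of a smooth map. The smooth structures on `X` and `Y` are those for which the coverings
`pX : E → X` and `pY : E' → Y` by vector spaces are local diffeomorphisms. -/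
def IsSmoothOn {E E' X Y : Type*} [NormedAddCommGroup E] [NormedSpace ℝ E]
    [NormedAddCommGroup E'] [NormedSpace ℝ E'] (pX : E → X) (pY : E' → Y)
    (f : X → Y) (S : Set X) : Prop :=
  ∀ e : E, pX e ∈ S → ∃ G : E → E', ContDiffAt ℝ ∞ G e ∧
    ∀ᶠ w in 𝓝 e, pX w ∈ S → f (pX w) = pY (G w)

/-- `f` restricts to a diffeomorphism of `S ⊆ X` onto `T ⊆ Y`. -/
def IsDiffeoOn {E E' X Y : Type*} [NormedAddCommGroup E] [NormedSpace ℝ E]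
    [NormedAddCommGroup E'] [NormedSpace ℝ E'] (pX : E → X) (pY : E' → Y)
    (f : X → Y) (S : Set X) (T : Set Y) : Prop :=
  BijOn f S T ∧ IsSmoothOn pX pY f S ∧
    ∃ k : Y → X, InvOn k f S T ∧ IsSmoothOn pY pX k T

/-! ### Euler–Lagrange equations, Finsler metrics, geodesic flow -/

/-- `c` is a solution of the Euler–Lagrange equation
`d/dt (∂_v Λ(t, c, ċ)) = ∂_x Λ(t, c, ċ)`, on the whole real line. -/
def IsEulerLagrange {E : Type*} [NormedAddCommGroup E] [NormedSpace ℝ E]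
    (Λ : ℝ → E → E → ℝ) (c : ℝ → E) : Prop :=
  ContDiff ℝ 2 c ∧
    ∀ t : ℝ, HasDerivAt (fun s : ℝ => fderiv ℝ (fun v : E => Λ s (c s) v) (deriv c s))
      (fderiv ℝ (fun x : E => Λ t x (deriv c t)) (c t)) t

/-- Finsler metrics on the torus. -/
structure IsFinsler (F : T2 → ℝ × ℝ → ℝ) : Prop where
  nonneg : ∀ x v, 0 ≤ F x v
  smooth : ContDiffOn ℝ ∞ (fun w : (ℝ × ℝ) × (ℝ × ℝ) => F (projT w.1) w.2) {w | w.2 ≠ 0}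
  homogeneous : ∀ x v, ∀ r : ℝ, 0 < r → F x (r • v) = r * F x v
  strongly_convex : ∀ x, ∀ v : ℝ × ℝ, v ≠ 0 → ∀ w : ℝ × ℝ, w ≠ 0 →
    0 < fderiv ℝ (fun u : ℝ × ℝ => fderiv ℝ (fun u' : ℝ × ℝ => (1 / 2) * F x u' ^ 2) u) v w w

/-- The unit tangent bundle `F⁻¹(1)`. -/
def unitTangent (F : T2 → ℝ × ℝ → ℝ) : Set TT2 := {u | F u.1 u.2 = 1}

/-- `γ` is a trajectory `t ↦ (c(t), ċ(t))` of the Euler–Lagrange flow of `F² / 2`. -/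
def IsGeodesicTrajectory (F : T2 → ℝ × ℝ → ℝ) (γ : ℝ → TT2) : Prop :=
  ∃ c : ℝ → ℝ × ℝ,
    IsEulerLagrange (fun _ x v => (1 / 2) * F (projT x) v ^ 2) c ∧
    ∀ t, γ t = projTT (c t, deriv c t)

/-- `φ` is the (complete) geodesic flow of `F` on the unit tangent bundle: it preserves the unit
tangent bundle, and `t ↦ φ t u` is the one and only geodesic trajectory starting at `u`. -/
def IsGeodesicFlow (F : T2 → ℝ × ℝ → ℝ) (φ : ℝ → TT2 → TT2) : Prop :=
  (∀ t, MapsTo (φ t) (unitTangent F) (unitTangent F)) ∧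
    ∀ u ∈ unitTangent F, ∀ γ : ℝ → TT2,
      (IsGeodesicTrajectory F γ ∧ γ 0 = u) ↔ ∀ t, γ t = φ t u

/-- `R` is (on `S`) the first return map of the flow `φ` to `S`; in particular every point of `S`
returns to `S`. -/
def IsFirstReturnMap (φ : ℝ → TT2 → TT2) (S : Set TT2) (R : TT2 → TT2) : Prop :=
  ∀ u ∈ S, ∃ τ : ℝ, 0 < τ ∧ φ τ u = R u ∧ R u ∈ S ∧ ∀ t ∈ Ioo 0 τ, φ t u ∉ S

/-- The section `V₀ = {(0, h, v) ∈ ST² | v₁ > 0}`. -/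
def V0 (F : T2 → ℝ × ℝ → ℝ) : Set TT2 :=
  {u | u ∈ unitTangent F ∧ u.1.1 = 0 ∧ 0 < u.2.1}

/-- The map `(0, h, v₁, v₂) ↦ (h, v₂ / v₁)`. -/
def slopeMap (u : TT2) : Cyl := (u.1.2, u.2.2 / u.2.1)

/-! ### The Hamiltonian, its Legendre transform, and time-one maps -/

/-- `H(t, x, y)` is a smooth Hamiltonian on `S¹`, 1-periodic in time, strictly convex in the
momentum `y`, and equal to `y² / 2 + D₊` for `y > D` and to `y² / 2 + D₋` for `y < -D`. -/
structure IsConvexHamiltonian (H : T2 → ℝ → ℝ) (D Dp Dm : ℝ) : Prop where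
  smooth : ContDiff ℝ ∞ (fun q : (ℝ × ℝ) × ℝ => H (projT q.1) q.2)
  convex : ∀ z y, 0 < deriv (deriv (H z)) y
  upper : ∀ z y, D < y → H z y = y ^ 2 / 2 + Dp
  lower : ∀ z y, y < -D → H z y = y ^ 2 / 2 + Dm

/-- Solutions of Hamilton's equations `ẋ = ∂_y H`, `ẏ = -∂_x H`, lifted to the plane. -/
def IsHamiltonSolution (H : T2 → ℝ → ℝ) (x y : ℝ → ℝ) : Prop :=
  ∀ t : ℝ, HasDerivAt x (deriv (H (projT (t, x t))) (y t)) t ∧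
    HasDerivAt y (-deriv (fun ξ : ℝ => H (projT (t, ξ)) (y t)) (x t)) t

/-- `f` is the time-one map (from time `0` to time `1`) of the Hamiltonian flow of `H`. -/
def IsHamiltonTimeOneMap (H : T2 → ℝ → ℝ) (f : Cyl → Cyl) : Prop :=
  ∀ z w : Cyl, f z = w ↔ ∃ x y : ℝ → ℝ, IsHamiltonSolution H x y ∧
    projZ (x 0, y 0) = z ∧ projZ (x 1, y 1) = w

/-- The Legendre transformation `(x, y) ↦ (x, ∂_y H(0, x, y))` at time `0`. -/
def legendreZero (H : T2 → ℝ → ℝ) (z : Cyl) : Cyl := (z.1, deriv (H (0, z.1)) z.2)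

/-- `E` is the time-one map of the Euler–Lagrange flow, in position-velocity coordinates, of the
time-periodic Lagrangian `L(t, x, y)` on the circle. -/
def IsLagrangeTimeOneMap (L : T2 → ℝ → ℝ) (E : Cyl → Cyl) : Prop :=
  ∀ z w : Cyl, E z = w ↔ ∃ θ : ℝ → ℝ,
    IsEulerLagrange (fun t x v => L (projT (t, x)) v) θ ∧
    projZ (θ 0, deriv θ 0) = z ∧ projZ (θ 1, deriv θ 1) = w

/-- The Lagrangian associated with `H`: the fibrewise Legendre transform. -/
def legendreDual (H : T2 → ℝ → ℝ) (z : T2) (v : ℝ) : ℝ := ⨆ y : ℝ, (y * v - H z y)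

/-- The Lagrangian `L`, obtained from the one of `H` by modification for large `|y|`. -/
def modifiedLagrangian (H : T2 → ℝ → ℝ) (D : ℝ) (hp hm : ℝ → ℝ) (z : T2) (y : ℝ) : ℝ :=
  if y < -D then hm y else if y ≤ D then legendreDual H z y else hp y

/-- The metric `F` built from a Lagrangian `L`: `F(t, x, v) = v₁ L(t, x, v₂ / v₁)` for `v₁ > 0` and
`F(t, x, v) = √(A v₁² + B v₂²)` for `v₁ ≤ 0`. -/
def finslerOf (A B : ℝ) (L : T2 → ℝ → ℝ) (z : T2) (v : ℝ × ℝ) : ℝ :=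
  if 0 < v.1 then v.1 * L z (v.2 / v.1) else Real.sqrt (A * v.1 ^ 2 + B * v.2 ^ 2)

end FinslerTwist

end

open Set Filter Topology
open scoped ContDiff Manifold

noncomputable section

namespace FinslerTwist

/-!
For `v₁ > 0` the metric `F` is the perspective of the Lagrangian `L`. At a unit vector of slope `u`
the fibre derivative of `F² / 2` is therefore `(-H(t, x, y), y)`, where `y` is the momentum of `u`.
Thus the geodesic equation says that `y` and the energy `H` evolve, up to the change of time
`dt = ds / L`, by Hamilton's equations: unit speed geodesics with `v₁ > 0`, reparametrised by their
first coordinate, are the graphs of the solutions of the Hamiltonian system, and the first return to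
`t = 0` is the time-one map. This needs `|u| ≤ D`, where `L` is the Lagrangian of `H`. On the
complementary cone `|v₂| ≥ D v₁` the metric does not depend on the base point, so the geodesics are
straight lines; they too are graphs of solutions, since `H = y² / 2 + const` for `|y| > D`.
-/

/-! ### Ordinary differential equations -/

section IntegralCurves

variable {E : Type*} [NormedAddCommGroup E] [NormedSpace ℝ E]

lemma eq_of_hasDerivAt_zero_of_mem {g : ℝ → E} (hg : Continuous g) {V : Set E} (hV : IsOpen V)
    (h : ∀ t, g t ∈ V → HasDerivAt g 0 t) {t₀ : ℝ} (ht₀ : g t₀ ∈ V) (t : ℝ) : g t = g t₀ := by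
  suffices hopen : IsOpen {s | g s = g t₀} by
    have huniv : {s | g s = g t₀} = univ :=
      IsClopen.eq_univ ⟨isClosed_singleton.preimage hg, hopen⟩ ⟨t₀, rfl⟩
    exact eq_univ_iff_forall.1 huniv t
  refine isOpen_iff_mem_nhds.2 fun s (hs : g s = g t₀) => ?_
  have hderiv : ∀ᶠ r in 𝓝 s, HasDerivAt g 0 r :=
    (hg.continuousAt.eventually_mem (hV.mem_nhds (hs ▸ ht₀))).mono h
  obtain ⟨ε, hε, hball⟩ := Metric.eventually_nhds_iff_ball.1 hderiv
  filter_upwards [Metric.ball_mem_nhds s hε] with r hr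
  refine hs ▸ (convex_ball s ε).is_const_of_fderivWithin_eq_zero (𝕜 := ℝ) (f := g)
    (fun x hx => (hball x hx).differentiableAt.differentiableWithinAt) (fun x hx => ?_) hr
    (Metric.mem_ball_self hε)
  rw [fderivWithin_of_isOpen Metric.isOpen_ball hx, (hball x hx).hasFDerivAt.fderiv,
    ContinuousLinearMap.toSpanSingleton_zero]

variable {X : E → E}

lemma contDiff_two_of_isIntegralCurve (hX : ContDiff ℝ 1 X) {γ : ℝ → E}
    (hγ : IsIntegralCurve γ fun _ => X) : ContDiff ℝ 2 γ := by
  have hdiff : Differentiable ℝ γ := fun t => (hγ t).differentiableAt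
  have hderiv : deriv γ = X ∘ γ := funext fun t => (hγ t).deriv
  have hone : ContDiff ℝ 1 γ := contDiff_one_iff_deriv.2
    ⟨hdiff, hderiv ▸ hX.continuous.comp hdiff.continuous⟩
  rw [← one_add_one_eq_two, contDiff_succ_iff_deriv, hderiv]
  exact ⟨hdiff, by simp, hX.comp hone⟩

lemma integralCurve_unique (hX : ContDiff ℝ 1 X) {γ γ' : ℝ → E}
    (hγ : IsIntegralCurve γ fun _ => X) (hγ' : IsIntegralCurve γ' fun _ => X)
    (h : γ 0 = γ' 0) : γ = γ' :=
  isMIntegralCurve_Ioo_eq_of_contMDiff_boundaryless (I := 𝓘(ℝ, E)) (t₀ := 0)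
    (contMDiff_vectorSpace_iff_contDiff.2 hX) (fun t => (hγ t).hasFDerivAt.hasMFDerivAt)
    (fun t => (hγ' t).hasFDerivAt.hasMFDerivAt) h

lemma exists_integralCurve_of_uniform_time (hX : ContDiff ℝ 1 X) {ε : ℝ} (hε : 0 < ε)
    (h : ∀ x, ∃ γ : ℝ → E, γ 0 = x ∧ ∀ t ∈ Ioo (-ε) ε, HasDerivAt γ (X (γ t)) t) (x : E) :
    ∃ γ : ℝ → E, γ 0 = x ∧ IsIntegralCurve γ fun _ => X := by
  obtain ⟨γ, hγ₀, hγ⟩ := exists_isMIntegralCurve_of_isMIntegralCurveOn (I := 𝓘(ℝ, E)) (v := X)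
    (contMDiff_vectorSpace_iff_contDiff.2 hX) hε (fun x => by
      obtain ⟨γ, hγ₀, hγ⟩ := h x
      exact ⟨γ, hγ₀, fun t ht => (hγ t ht).hasFDerivAt.hasMFDerivAt.hasMFDerivWithinAt⟩) x
  refine ⟨γ, hγ₀, fun t => ?_⟩
  have hderiv : HasFDerivAt γ ((1 : ℝ →L[ℝ] ℝ).smulRight (X (γ t))) t :=
    hasMFDerivAt_iff_hasFDerivAt.1 (hγ t)
  simpa using hderiv.hasDerivAt

lemma exists_uniform_time_of_isCompact [CompleteSpace E] (hX : ContDiff ℝ 1 X) {K : Set E}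
    (hK : IsCompact K) :
    ∃ ε > 0, ∀ x ∈ K, ∃ γ : ℝ → E,
      γ 0 = x ∧ ∀ t ∈ Ioo (-ε) ε, HasDerivAt γ (X (γ t)) t := by
  refine hK.induction_on ⟨1, one_pos, by simp⟩ ?_ ?_ fun x _ => ?_
  · rintro s t hst ⟨ε, hε, h⟩
    exact ⟨ε, hε, fun x hx => h x (hst hx)⟩
  · rintro s t ⟨ε, hε, h⟩ ⟨δ, hδ, h'⟩
    refine ⟨min ε δ, lt_min hε hδ, ?_⟩
    have hleft : Ioo (-min ε δ) (min ε δ) ⊆ Ioo (-ε) ε :=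
      Ioo_subset_Ioo (neg_le_neg (min_le_left ε δ)) (min_le_left ε δ)
    have hright : Ioo (-min ε δ) (min ε δ) ⊆ Ioo (-δ) δ :=
      Ioo_subset_Ioo (neg_le_neg (min_le_right ε δ)) (min_le_right ε δ)
    rintro x (hx | hx)
    · obtain ⟨γ, hγ₀, hγ⟩ := h x hx
      exact ⟨γ, hγ₀, fun t ht => hγ t (hleft ht)⟩
    · obtain ⟨γ, hγ₀, hγ⟩ := h' x hx
      exact ⟨γ, hγ₀, fun t ht => hγ t (hright ht)⟩
  · obtain ⟨r, hr, ε, hε, h⟩ :=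
      hX.contDiffAt.exists_forall_mem_closedBall_exists_eq_forall_mem_Ioo_hasDerivAt 0
    refine ⟨Metric.closedBall x r, mem_nhdsWithin_of_mem_nhds (Metric.closedBall_mem_nhds x hr),
      ε, hε, fun z hz => ?_⟩
    simpa only [zero_sub, zero_add] using h z hz

end IntegralCurves

section RealFunctions

lemma strictMono_of_forall_le_deriv {σ σ' : ℝ → ℝ} (hσ : ∀ t, HasDerivAt σ (σ' t) t) {b : ℝ}
    (hb : 0 < b) (hσ' : ∀ t, b ≤ σ' t) : StrictMono σ :=
  strictMono_of_deriv_pos fun t => (hσ t).deriv ▸ hb.trans_le (hσ' t)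

lemma surjective_of_forall_le_deriv {σ σ' : ℝ → ℝ} (hσ : ∀ t, HasDerivAt σ (σ' t) t) {b : ℝ}
    (hb : 0 < b) (hσ' : ∀ t, b ≤ σ' t) : Function.Surjective σ := by
  have hmono : Monotone fun t => σ t - b * t :=
    monotone_of_hasDerivAt_nonneg (f' := fun t => σ' t - b * 1)
      (fun t => (hσ t).sub ((hasDerivAt_id t).const_mul b)) fun t => by
        have := hσ' t
        simp only [Pi.zero_apply, mul_one, sub_nonneg, this]
  have htop : Tendsto (fun t => b * t + σ 0) atTop atTop :=
    tendsto_atTop_add_const_right _ _ (tendsto_id.const_mul_atTop hb)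
  have hbot : Tendsto (fun t => b * t + σ 0) atBot atBot :=
    tendsto_atBot_add_const_right _ _ (tendsto_id.const_mul_atBot hb)
  refine Continuous.surjective (continuous_iff_continuousAt.2 fun t => (hσ t).continuousAt)
    (tendsto_atTop_mono' _ ?_ htop) (tendsto_atBot_mono' _ ?_ hbot)
  · filter_upwards [eventually_ge_atTop 0] with t ht
    have := hmono ht
    simp only at this
    linarith
  · filter_upwards [eventually_le_atBot 0] with t ht
    have := hmono ht
    simp only at this
    linarith

lemma exists_inverse_of_forall_le_deriv {σ σ' : ℝ → ℝ} (hσ : ∀ t, HasDerivAt σ (σ' t) t) {b : ℝ}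
    (hb : 0 < b) (hσ' : ∀ t, b ≤ σ' t) :
    ∃ τ : ℝ → ℝ, (∀ s, σ (τ s) = s) ∧ ∀ s, HasDerivAt τ (σ' (τ s))⁻¹ s := by
  let e := (strictMono_of_forall_le_deriv hσ hb hσ').orderIsoOfSurjective σ
    (surjective_of_forall_le_deriv hσ hb hσ')
  refine ⟨e.symm, e.apply_symm_apply, fun s => ?_⟩
  exact HasDerivAt.of_local_left_inverse e.symm.continuous.continuousAt (hσ _)
    (hb.trans_le (hσ' _)).ne' (Eventually.of_forall e.apply_symm_apply)

lemma add_deriv_mul_sub_le {g : ℝ → ℝ} (hg : ContDiff ℝ 2 g) (hg'' : ∀ y, 0 < deriv (deriv g) y)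
    (a x : ℝ) : g a + deriv g a * (x - a) ≤ g x := by
  have hdiff : Differentiable ℝ g := hg.differentiable (by norm_num)
  have hconvex : ConvexOn ℝ univ g :=
    (strictConvexOn_univ_of_deriv2_pos hg.continuous hg'').convexOn
  rcases lt_trichotomy a x with hax | rfl | hxa
  · have := hconvex.deriv_le_slope (mem_univ a) (mem_univ x) hax (hdiff a)
    rw [slope_def_field, le_div_iff₀ (sub_pos.2 hax)] at this
    linarith
  · simp
  · have := hconvex.slope_le_deriv (mem_univ x) (mem_univ a) hxa (hdiff a)
    rw [slope_def_field, div_le_iff₀ (sub_pos.2 hxa)] at this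
    linarith

end RealFunctions

/-! ### The fibrewise Legendre transform -/

section FibrewiseLegendre

variable {E : Type*} [NormedAddCommGroup E] [NormedSpace ℝ E]

/-- The derivative in the fibre direction of a Hamiltonian `h` on `E × ℝ`, that is, the velocity as
a function of the parameter and the momentum. -/
def velocity (h : E × ℝ → ℝ) (q : E × ℝ) : ℝ := fderiv ℝ h q (0, 1)

/-- The momentum as a function of the parameter and the velocity: the fibrewise inverse of
`velocity h`. -/
def momentum (h : E × ℝ → ℝ) (q : E × ℝ) : ℝ :=
  Function.invFun (fun y => velocity h (q.1, y)) q.2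

/-- The Legendre transform in the fibre direction, expressed through the momentum. -/
def fibreLegendre (h : E × ℝ → ℝ) (q : E × ℝ) : ℝ :=
  momentum h q * q.2 - h (q.1, momentum h q)

/-- The smooth Hamiltonians on `E × ℝ` that are strictly convex in the fibres and whose fibrewise
Legendre transformation is onto. -/
structure IsLegendreRegular (h : E × ℝ → ℝ) : Prop where
  smooth : ContDiff ℝ ∞ h
  convex : ∀ p y, 0 < deriv (deriv fun z => h (p, z)) y
  surjective : ∀ p, Function.Surjective fun y => velocity h (p, y)

variable {h : E × ℝ → ℝ}

lemma hasDerivAt_fibre (hh : Differentiable ℝ h) (p : E) (y : ℝ) :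
    HasDerivAt (fun z => h (p, z)) (velocity h (p, y)) y :=
  (hh (p, y)).hasFDerivAt.comp_hasDerivAt y ((hasDerivAt_const y p).prodMk (hasDerivAt_id y))

lemma deriv_fibre (hh : Differentiable ℝ h) (p : E) :
    deriv (fun z => h (p, z)) = fun y => velocity h (p, y) :=
  funext fun y => (hasDerivAt_fibre hh p y).deriv

lemma contDiff_velocity (hh : ContDiff ℝ ∞ h) : ContDiff ℝ ∞ (velocity h) :=
  (hh.fderiv_right (m := ∞) (by simp)).clm_apply contDiff_const

lemma contDiff_of_fibrewise_inverse [CompleteSpace E] {g k : E × ℝ → ℝ} {n : WithTop ℕ∞}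
    (hn : n ≠ 0) (hg : ContDiff ℝ n g) (hg' : ∀ q, velocity g q ≠ 0)
    (hinj : ∀ p, Function.Injective fun y => g (p, y)) (hgk : ∀ q, g (q.1, k q) = q.2) :
    ContDiff ℝ n k := by
  refine contDiff_iff_contDiffAt.2 fun q => ?_
  let Γ : (E × ℝ) × ℝ → ℝ := fun u => g (u.1.1, u.2) - u.1.2
  have hΓ : ContDiffAt ℝ n Γ (q, k q) := by fun_prop
  have hpartial : fderiv ℝ Γ (q, k q) ∘L .inr ℝ (E × ℝ) ℝ =
      .toSpanSingleton ℝ (velocity g (q.1, k q)) := by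
    ext
    have hΓ' := (hΓ.differentiableAt hn).hasFDerivAt.comp_hasDerivAt (k q)
      ((hasDerivAt_const (k q) q).prodMk (hasDerivAt_id (k q)))
    have hg₂ := ((hasDerivAt_fibre (hg.differentiable hn) q.1 (k q)).sub_const q.2)
    simpa using hΓ'.unique hg₂
  have hinv : (fderiv ℝ Γ (q, k q) ∘L .inr ℝ (E × ℝ) ℝ).IsInvertible := by
    rw [hpartial]
    exact ⟨ContinuousLinearEquiv.unitsEquivAut ℝ (Units.mk0 _ (hg' (q.1, k q))), by
      ext; simp⟩
  refine (hΓ.contDiffAt_implicitFunction hn hinv).congr_of_eventuallyEq ?_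
  filter_upwards [hΓ.eventually_apply_implicitFunction hn hinv] with w hw
  refine hinj w.1 ((hgk w).trans ?_)
  have hzero : Γ (q, k q) = 0 := sub_eq_zero.2 (hgk q)
  exact (sub_eq_zero.1 (hw.trans hzero)).symm

namespace IsLegendreRegular

variable (hh : IsLegendreRegular h)
include hh

lemma differentiable : Differentiable ℝ h := hh.smooth.differentiable (by simp)

lemma hasDerivAt_velocity (p : E) (y : ℝ) :
    HasDerivAt (fun z => velocity h (p, z)) (deriv (deriv fun z => h (p, z)) y) y := by
  rw [deriv_fibre hh.differentiable]
  exact (((contDiff_velocity hh.smooth).comp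
    (contDiff_const.prodMk contDiff_id)).differentiable (by simp) y).hasDerivAt

lemma strictMono_velocity (p : E) : StrictMono fun y => velocity h (p, y) :=
  strictMono_of_deriv_pos fun y => (hh.hasDerivAt_velocity p y).deriv ▸ hh.convex p y

lemma velocity_momentum (p : E) (v : ℝ) : velocity h (p, momentum h (p, v)) = v :=
  Function.rightInverse_invFun (hh.surjective p) v

lemma momentum_velocity (p : E) (y : ℝ) : momentum h (p, velocity h (p, y)) = y :=
  Function.leftInverse_invFun (hh.strictMono_velocity p).injective y

lemma velocity_eq_iff {p : E} {y v : ℝ} : velocity h (p, y) = v ↔ momentum h (p, v) = y :=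
  ⟨fun hv => hv ▸ hh.momentum_velocity p y, fun hy => hy ▸ hh.velocity_momentum p v⟩

lemma contDiff_momentum [CompleteSpace E] : ContDiff ℝ ∞ (momentum h) :=
  contDiff_of_fibrewise_inverse (by simp) (contDiff_velocity hh.smooth)
    (fun q => by
      have hvel := (hasDerivAt_fibre
        ((contDiff_velocity hh.smooth).differentiable (by simp)) q.1 q.2).unique
        (hh.hasDerivAt_velocity q.1 q.2)
      exact hvel.trans_ne (hh.convex q.1 q.2).ne')
    (fun p => (hh.strictMono_velocity p).injective) fun q => hh.velocity_momentum q.1 q.2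

lemma hasDerivAt_momentum [CompleteSpace E] (p : E) (v : ℝ) :
    HasDerivAt (fun w => momentum h (p, w))
      (deriv (deriv fun z => h (p, z)) (momentum h (p, v)))⁻¹ v :=
  HasDerivAt.of_local_left_inverse
    (hh.contDiff_momentum.continuous.comp (by fun_prop : Continuous fun w => (p, w))).continuousAt
    (hh.hasDerivAt_velocity p _) (hh.convex p _).ne'
    (Eventually.of_forall fun w => hh.velocity_momentum p w)

lemma contDiff_fibreLegendre [CompleteSpace E] : ContDiff ℝ ∞ (fibreLegendre h) :=
  (hh.contDiff_momentum.mul contDiff_snd).sub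
    (hh.smooth.comp (contDiff_fst.prodMk hh.contDiff_momentum))

/- Envelope formula: the derivative of the momentum drops out since the momentum is a critical point
of `y ↦ y * v - h (p, y)`. -/
lemma fderiv_fibreLegendre [CompleteSpace E] (q w : E × ℝ) :
    fderiv ℝ (fibreLegendre h) q w =
      momentum h q * w.2 - fderiv ℝ h (q.1, momentum h q) (w.1, 0) := by
  have hmom : HasFDerivAt (momentum h) (fderiv ℝ (momentum h) q) q :=
    (hh.contDiff_momentum.differentiable (by simp) q).hasFDerivAt
  have hlegendre : HasFDerivAt (fibreLegendre h) _ q := (hmom.mul hasFDerivAt_snd).sub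
    ((hh.differentiable (q.1, momentum h q)).hasFDerivAt.comp q (hasFDerivAt_fst.prodMk hmom))
  have hsplit : fderiv ℝ h (q.1, momentum h q) (w.1, fderiv ℝ (momentum h) q w) =
      fderiv ℝ h (q.1, momentum h q) (w.1, 0) + fderiv ℝ (momentum h) q w * q.2 := by
    have hvel : fderiv ℝ h (q.1, momentum h q) (0, 1) = q.2 := hh.velocity_momentum q.1 q.2
    rw [← hvel, ← smul_eq_mul, ← map_smul, ← map_add]
    simp
  rw [hlegendre.fderiv]
  simp [hsplit]
  ring

lemma hasDerivAt_fibreLegendre [CompleteSpace E] (p : E) (v : ℝ) :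
    HasDerivAt (fun w => fibreLegendre h (p, w)) (momentum h (p, v)) v := by
  refine (hasDerivAt_fibre (hh.contDiff_fibreLegendre.differentiable (by simp)) p v).congr_deriv ?_
  rw [velocity, hh.fderiv_fibreLegendre, mul_one, Prod.mk_zero_zero, map_zero, sub_zero]

lemma deriv_deriv_fibreLegendre_pos [CompleteSpace E] (p : E) (v : ℝ) :
    0 < deriv (deriv fun w => fibreLegendre h (p, w)) v := by
  rw [funext fun w => (hh.hasDerivAt_fibreLegendre p w).deriv, (hh.hasDerivAt_momentum p v).deriv]
  exact inv_pos.2 (hh.convex p _)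

lemma iSup_sub_eq_fibreLegendre (p : E) (v : ℝ) :
    ⨆ y, (y * v - h (p, y)) = fibreLegendre h (p, v) := by
  have hle : ∀ y, y * v - h (p, y) ≤ fibreLegendre h (p, v) := fun y => by
    have hfibre : ContDiff ℝ 2 fun z => h (p, z) :=
      (hh.smooth.comp (contDiff_const.prodMk contDiff_id)).of_le (by norm_cast)
    have htangent := add_deriv_mul_sub_le hfibre (hh.convex p) (momentum h (p, v)) y
    simp only [deriv_fibre hh.differentiable, hh.velocity_momentum] at htangent
    simp only [fibreLegendre]
    linarith
  exact le_antisymm (ciSup_le hle) (le_ciSup ⟨_, forall_mem_range.2 hle⟩ (momentum h (p, v)))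

end IsLegendreRegular

end FibrewiseLegendre

/-! ### Time-periodic Hamiltonians on the circle -/

lemma projT_surjective : Function.Surjective projT :=
  QuotientAddGroup.mk_surjective.prodMap QuotientAddGroup.mk_surjective

lemma projT_add_of_eq_zero {k : ℝ × ℝ} (hk : projT k = 0) (p : ℝ × ℝ) :
    projT (p + k) = projT p :=
  (congrArg (projT p + ·) hk).trans (add_zero _)

lemma coe_eq_zero_iff_exists_int {r : ℝ} : (r : S1) = 0 ↔ ∃ n : ℤ, (n : ℝ) = r := by
  simp only [AddCircle.coe_eq_zero_iff, zsmul_one]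

lemma exists_projT_eq_zero_add_mem_Icc (p : ℝ × ℝ) : ∃ k, projT k = 0 ∧ p + k ∈ Icc 0 1 := by
  have hint : ∀ n : ℤ, ((n : ℝ) : S1) = 0 := fun n => coe_eq_zero_iff_exists_int.2 ⟨n, rfl⟩
  refine ⟨((-⌊p.1⌋ : ℤ), (-⌊p.2⌋ : ℤ)), Prod.ext (hint _) (hint _), ?_, ?_⟩ <;>
    constructor <;> push_cast <;> simp [← sub_eq_add_neg, (Int.fract_lt_one _).le]

/-- The lift to the universal covering of a function on `T² × ℝ`. -/
def lift (H : T2 → ℝ → ℝ) (q : (ℝ × ℝ) × ℝ) : ℝ := H (projT q.1) q.2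

section Periodicity

variable {H : T2 → ℝ → ℝ} {k : ℝ × ℝ} (hk : projT k = 0)
include hk

lemma lift_add_of_projT_eq_zero (q : (ℝ × ℝ) × ℝ) : lift H (q + (k, 0)) = lift H q := by
  simp only [lift, Prod.fst_add, Prod.snd_add, add_zero, projT_add_of_eq_zero hk]

lemma fderiv_lift_add_of_projT_eq_zero (q : (ℝ × ℝ) × ℝ) :
    fderiv ℝ (lift H) (q + (k, 0)) = fderiv ℝ (lift H) q := by
  rw [← fderiv_comp_add_right]
  simp only [lift_add_of_projT_eq_zero hk]

lemma velocity_add_of_projT_eq_zero (q : (ℝ × ℝ) × ℝ) :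
    velocity (lift H) (q + (k, 0)) = velocity (lift H) q := by
  rw [velocity, fderiv_lift_add_of_projT_eq_zero hk, velocity]

end Periodicity

lemma hasDerivAt_position {h : (ℝ × ℝ) × ℝ → ℝ} (hh : Differentiable ℝ h) (t x y : ℝ) :
    HasDerivAt (fun ξ => h ((t, ξ), y)) (fderiv ℝ h ((t, x), y) ((0, 1), 0)) x :=
  (hh ((t, x), y)).hasFDerivAt.comp_hasDerivAt x
    (((hasDerivAt_const x t).prodMk (hasDerivAt_id x)).prodMk (hasDerivAt_const x y))

lemma isHamiltonSolution_iff {H : T2 → ℝ → ℝ} (hH : Differentiable ℝ (lift H)) {x y : ℝ → ℝ} :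
    IsHamiltonSolution H x y ↔ ∀ t, HasDerivAt x (velocity (lift H) ((t, x t), y t)) t ∧
      HasDerivAt y (-fderiv ℝ (lift H) ((t, x t), y t) ((0, 1), 0)) t := by
  refine forall_congr' fun t => ?_
  rw [← (hasDerivAt_fibre hH (t, x t) (y t)).deriv, ← (hasDerivAt_position hH t (x t) (y t)).deriv]
  rfl

namespace IsHamiltonSolution

variable {H : T2 → ℝ → ℝ} (hH : ContDiff ℝ ∞ (lift H)) {x y : ℝ → ℝ}
  (hxy : IsHamiltonSolution H x y)
include hH hxy

lemma deriv_position (t : ℝ) : deriv x t = velocity (lift H) ((t, x t), y t) :=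
  ((isHamiltonSolution_iff (hH.differentiable (by simp))).1 hxy t).1.deriv

lemma contDiff_position : ContDiff ℝ 2 x := by
  have hsol := (isHamiltonSolution_iff (hH.differentiable (by simp))).1 hxy
  set X : (ℝ × ℝ) × ℝ → (ℝ × ℝ) × ℝ := fun q =>
    ((1, velocity (lift H) q), -fderiv ℝ (lift H) q ((0, 1), 0))
  have hX : ContDiff ℝ 1 X :=
    ((contDiff_const.prodMk ((contDiff_velocity hH).of_le (by norm_cast))).prodMk
      ((hH.fderiv_right (m := 1) (by norm_cast)).clm_apply contDiff_const).neg)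
  have hcurve : IsIntegralCurve (fun t => ((t, x t), y t)) fun _ => X := fun t =>
    ((hasDerivAt_id t).prodMk (hsol t).1).prodMk (hsol t).2
  exact contDiff_snd.comp (contDiff_fst.comp (contDiff_two_of_isIntegralCurve hX hcurve))

end IsHamiltonSolution

namespace IsConvexHamiltonian

variable {H : T2 → ℝ → ℝ} {D Dp Dm : ℝ} (hH : IsConvexHamiltonian H D Dp Dm)
include hH

lemma contDiff_lift : ContDiff ℝ ∞ (lift H) := hH.smooth

lemma differentiable_lift : Differentiable ℝ (lift H) := hH.contDiff_lift.differentiable (by simp)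

lemma velocity_of_lt_abs (p : ℝ × ℝ) {y : ℝ} (hy : D < |y|) : velocity (lift H) (p, y) = y := by
  obtain ⟨d, hd⟩ : ∃ d, H (projT p) =ᶠ[𝓝 y] fun z => z ^ 2 / 2 + d := by
    rcases lt_abs.1 hy with hy | hy
    · exact ⟨Dp, (lt_mem_nhds hy).mono fun z => hH.upper _ z⟩
    · exact ⟨Dm, (gt_mem_nhds (lt_neg.1 hy)).mono fun z => hH.lower _ z⟩
  have hfibre : HasDerivAt (H (projT p)) _ y := hasDerivAt_fibre hH.differentiable_lift p y
  rw [← hfibre.deriv, hd.deriv_eq]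
  simp

lemma isLegendreRegular_lift : IsLegendreRegular (lift H) where
  smooth := hH.contDiff_lift
  convex p := hH.convex (projT p)
  surjective p v := by
    have hcont : Continuous fun y => velocity (lift H) (p, y) :=
      (contDiff_velocity hH.contDiff_lift).continuous.comp (by fun_prop)
    obtain ⟨M, hM⟩ := exists_gt (max |v| D)
    obtain ⟨hvM, hDM⟩ := max_lt_iff.1 hM
    have hM_abs : M = |M| := (abs_of_pos ((abs_nonneg v).trans_lt hvM)).symm
    refine mem_range_of_exists_le_of_exists_ge hcont ⟨-M, ?_⟩ ⟨M, ?_⟩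
    · rw [hH.velocity_of_lt_abs p (by rwa [abs_neg, ← hM_abs])]
      linarith [neg_abs_le v]
    · rw [hH.velocity_of_lt_abs p (by rwa [← hM_abs])]
      linarith [le_abs_self v]

lemma abs_velocity_le_iff {p : ℝ × ℝ} {y : ℝ} : |velocity (lift H) (p, y)| ≤ D ↔ |y| ≤ D := by
  rw [← not_lt, ← not_lt, not_iff_not]
  refine ⟨fun hv => ?_, fun hy => by rwa [hH.velocity_of_lt_abs p hy]⟩
  have hyv := (hH.isLegendreRegular_lift.strictMono_velocity p).injective
    (hH.velocity_of_lt_abs p hv)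
  rwa [← hyv]

lemma momentum_of_lt_abs (p : ℝ × ℝ) {v : ℝ} (hv : D < |v|) : momentum (lift H) (p, v) = v :=
  hH.isLegendreRegular_lift.velocity_eq_iff.1 (hH.velocity_of_lt_abs p hv)

lemma lift_eq_of_lt_abs (p p' : ℝ × ℝ) {y : ℝ} (hy : D < |y|) : lift H (p, y) = lift H (p', y) := by
  rcases lt_abs.1 hy with hy | hy
  · exact (hH.upper _ _ hy).trans (hH.upper _ _ hy).symm
  · exact (hH.lower _ _ (lt_neg.1 hy)).trans (hH.lower _ _ (lt_neg.1 hy)).symm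

lemma fderiv_lift_position_of_lt_abs (p : ℝ × ℝ) {y : ℝ} (hy : D < |y|) :
    fderiv ℝ (lift H) (p, y) ((0, 1), 0) = 0 :=
  (hasDerivAt_position hH.differentiable_lift p.1 p.2 y).unique <|
    (hasDerivAt_const p.2 (lift H (0, y))).congr_of_eventuallyEq <|
      Eventually.of_forall fun _ => hH.lift_eq_of_lt_abs _ _ hy

lemma momentum_eq_of_lt_abs {x y : ℝ → ℝ} (hxy : IsHamiltonSolution H x y) {t₀ : ℝ}
    (ht₀ : D < |y t₀|) (t : ℝ) : y t = y t₀ := by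
  have hsol := (isHamiltonSolution_iff hH.differentiable_lift).1 hxy
  refine eq_of_hasDerivAt_zero_of_mem
    (continuous_iff_continuousAt.2 fun t => (hsol t).2.continuousAt)
    (isOpen_lt continuous_const continuous_abs) (fun s hs => ?_) ht₀ t
  exact (hsol s).2.congr_deriv (by rw [hH.fderiv_lift_position_of_lt_abs _ hs, neg_zero])

lemma fibreLegendre_of_lt (p : ℝ × ℝ) {v : ℝ} (hv : D < v) :
    fibreLegendre (lift H) (p, v) = v ^ 2 / 2 - Dp := by
  rw [fibreLegendre, hH.momentum_of_lt_abs p (lt_abs.2 (.inl hv)), lift, hH.upper _ _ hv]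
  ring

lemma fibreLegendre_of_lt_neg (p : ℝ × ℝ) {v : ℝ} (hv : v < -D) :
    fibreLegendre (lift H) (p, v) = v ^ 2 / 2 - Dm := by
  rw [fibreLegendre, hH.momentum_of_lt_abs p (lt_abs.2 (.inr (lt_neg.2 hv))), lift,
    hH.lower _ _ hv]
  ring

lemma legendreDual_projT (p : ℝ × ℝ) (v : ℝ) :
    legendreDual H (projT p) v = fibreLegendre (lift H) (p, v) :=
  hH.isLegendreRegular_lift.iSup_sub_eq_fibreLegendre p v

end IsConvexHamiltonian

/-! ### Euler–Lagrange equations -/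

section EulerLagrange

variable {E : Type*} [NormedAddCommGroup E] [NormedSpace ℝ E]

lemma fderiv_fderiv_apply_of_line {Q : E → ℝ} {v w : E} (hQ : ContDiffAt ℝ 2 Q v) {g : ℝ → ℝ}
    {g' : ℝ} (hg : ∀ᶠ s in 𝓝 (0 : ℝ), HasDerivAt (fun s : ℝ => Q (v + s • w)) (g s) s)
    (hg' : HasDerivAt g g' 0) : fderiv ℝ (fderiv ℝ Q) v w w = g' := by
  have hline : ∀ s : ℝ, HasDerivAt (fun s : ℝ => v + s • w) w s := fun s => by
    simpa using ((hasDerivAt_id s).smul_const w).const_add v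
  have htendsto : Tendsto (fun s : ℝ => v + s • w) (𝓝 0) (𝓝 v) := by
    simpa using (hline 0).continuousAt.tendsto
  have hQ' : ∀ᶠ u in 𝓝 v, DifferentiableAt ℝ Q u :=
    (hQ.eventually (by simp)).mono fun u hu => hu.differentiableAt (by simp)
  have hfderiv : DifferentiableAt ℝ (fderiv ℝ Q) v :=
    (hQ.fderiv_right (m := 1) (by norm_num [one_add_one_eq_two])).differentiableAt (by simp)
  have hsecond : HasDerivAt (fun s : ℝ => fderiv ℝ Q (v + s • w) w)
      (fderiv ℝ (fderiv ℝ Q) v w w) 0 := by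
    have hcomp := hfderiv.hasFDerivAt.comp_hasDerivAt_of_eq (0 : ℝ) (hline 0) (by simp)
    simpa using hcomp.clm_apply (hasDerivAt_const (0 : ℝ) w)
  refine hsecond.unique (hg'.congr_of_eventuallyEq ?_)
  filter_upwards [hg, htendsto.eventually hQ'] with s hs hQs
  exact (hQs.hasFDerivAt.comp_hasDerivAt s (hline s)).unique hs

lemma fderiv_fderiv_apply_real {g : ℝ → ℝ} (hg : ContDiff ℝ 2 g) (v w : ℝ) :
    fderiv ℝ (fderiv ℝ g) v w w = w ^ 2 * deriv (deriv g) v := by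
  have hline : ∀ s : ℝ, HasDerivAt (fun s : ℝ => v + s • w) w s := fun s => by
    simpa using ((hasDerivAt_id s).mul_const w).const_add v
  have hg' : ContDiff ℝ 1 (deriv g) :=
    (contDiff_succ_iff_deriv.1 (one_add_one_eq_two (R := WithTop ℕ∞) ▸ hg)).2.2
  refine fderiv_fderiv_apply_of_line hg.contDiffAt (g := fun s => deriv g (v + s • w) * w)
    (Eventually.of_forall fun s =>
      ((hg.differentiable (by simp) _).hasDerivAt.comp s (hline s))) ?_
  have hsecond := (hg'.differentiable (by simp) v).hasDerivAt.comp_of_eq (0 : ℝ) (hline 0) (by simp)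
  exact (hsecond.mul_const w).congr_deriv (by ring)

variable {Λ : ℝ → E → E → ℝ} {Λ₀ : E → ℝ} {U : Set E} {c : ℝ → E}

lemma hasDerivAt_deriv_of_contDiff_two (hc : ContDiff ℝ 2 c) (t : ℝ) :
    HasDerivAt (deriv c) (deriv (deriv c) t) t := by
  rw [← one_add_one_eq_two, contDiff_succ_iff_deriv] at hc
  exact (hc.2.2.differentiable (by simp) t).hasDerivAt

lemma fderiv_fibre_of_eq_on (hU : IsOpen U) (hΛ : ∀ t x, ∀ v ∈ U, Λ t x v = Λ₀ v) (t : ℝ) (x : E)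
    {v : E} (hv : v ∈ U) : fderiv ℝ (Λ t x) v = fderiv ℝ Λ₀ v :=
  EventuallyEq.fderiv_eq (eventually_of_mem (hU.mem_nhds hv) (hΛ t x))

lemma fderiv_base_of_eq_on (hΛ : ∀ t x, ∀ v ∈ U, Λ t x v = Λ₀ v) (t : ℝ) (x : E) {v : E}
    (hv : v ∈ U) : fderiv ℝ (fun x => Λ t x v) x = 0 := by
  rw [funext fun x => hΛ t x v hv, fderiv_fun_const, Pi.zero_apply]

lemma isEulerLagrange_of_hasDerivAt_const (hU : IsOpen U)
    (hΛ : ∀ t x, ∀ v ∈ U, Λ t x v = Λ₀ v) {v : E} (hv : v ∈ U) (hc : ∀ t, HasDerivAt c v t) :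
    IsEulerLagrange Λ c := by
  have hc' : deriv c = fun _ => v := funext fun t => (hc t).deriv
  refine ⟨?_, fun t => ?_⟩
  · rw [← one_add_one_eq_two, contDiff_succ_iff_deriv, hc']
    exact ⟨fun t => (hc t).differentiableAt, by simp, contDiff_const⟩
  · simp only [hc', fderiv_base_of_eq_on hΛ _ _ hv, fderiv_fibre_of_eq_on hU hΛ _ _ hv]
    exact hasDerivAt_const t _

/- On `U` the momentum depends on the velocity only and is conserved; by nondegeneracy so is the
velocity, which therefore never leaves `U`. -/
lemma IsEulerLagrange.deriv_eq_of_mem (hc : IsEulerLagrange Λ c) (hU : IsOpen U)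
    (hΛ : ∀ t x, ∀ v ∈ U, Λ t x v = Λ₀ v) (hΛ₀ : ContDiffOn ℝ 2 Λ₀ U)
    (hconv : ∀ v ∈ U, ∀ w, w ≠ 0 → 0 < fderiv ℝ (fderiv ℝ Λ₀) v w w) {t₀ : ℝ}
    (ht₀ : deriv c t₀ ∈ U) (t : ℝ) : deriv c t = deriv c t₀ := by
  have hcont : Continuous (deriv c) := hc.1.continuous_deriv (by simp)
  refine eq_of_hasDerivAt_zero_of_mem hcont hU (fun s hs => ?_) ht₀ t
  have hacc := hasDerivAt_deriv_of_contDiff_two hc.1 s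
  suffices hzero : deriv (deriv c) s = 0 by rwa [hzero] at hacc
  have hmom : HasDerivAt (fun r => fderiv ℝ Λ₀ (deriv c r)) 0 s := by
    have hEL := hc.2 s
    rw [fderiv_base_of_eq_on hΛ _ _ hs] at hEL
    refine hEL.congr_of_eventuallyEq ?_
    filter_upwards [hcont.continuousAt.eventually (hU.mem_nhds hs)] with r hr
    exact (fderiv_fibre_of_eq_on hU hΛ _ _ hr).symm
  have hfderiv : DifferentiableAt ℝ (fderiv ℝ Λ₀) (deriv c s) :=
    ((hΛ₀.contDiffAt (hU.mem_nhds hs)).fderiv_right (m := 1)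
      (by norm_num [one_add_one_eq_two])).differentiableAt (by simp)
  by_contra hne
  have hpos := hconv _ hs _ hne
  rw [(hfderiv.hasFDerivAt.comp_hasDerivAt s hacc).unique hmom] at hpos
  exact lt_irrefl _ hpos

end EulerLagrange

lemma isEulerLagrange_lift_iff {L : T2 → ℝ → ℝ} (hL : Differentiable ℝ (lift L)) {θ : ℝ → ℝ} :
    IsEulerLagrange (fun t x v => L (projT (t, x)) v) θ ↔ ContDiff ℝ 2 θ ∧
      ∀ t, HasDerivAt (fun s => velocity (lift L) ((s, θ s), deriv θ s))
        (fderiv ℝ (lift L) ((t, θ t), deriv θ t) ((0, 1), 0)) t := by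
  have hfibre : ∀ t x v, fderiv ℝ (fun v => L (projT (t, x)) v) v =
      .toSpanSingleton ℝ (velocity (lift L) ((t, x), v)) := fun t x v =>
    (hasDerivAt_fibre hL (t, x) v).hasFDerivAt.fderiv
  have hbase : ∀ t x v, fderiv ℝ (fun x => L (projT (t, x)) v) x =
      .toSpanSingleton ℝ (fderiv ℝ (lift L) ((t, x), v) ((0, 1), 0)) := fun t x v =>
    (hasDerivAt_position hL t x v).hasFDerivAt.fderiv
  simp only [IsEulerLagrange, hfibre, hbase]
  refine and_congr_right fun _ => forall_congr' fun t => ⟨fun h => ?_, fun h => ?_⟩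
  · simpa using h.clm_apply (hasDerivAt_const t (1 : ℝ))
  · exact (ContinuousLinearMap.toSpanSingletonCLE (𝕜 := ℝ) (E := ℝ)).hasFDerivAt.comp_hasDerivAt
      t h

/-! ### Twist Lagrangians -/

/-- The properties of the modified Lagrangian that determine its geodesics: `L` is smooth,
positive and strictly convex in the fibres, it is dual to `H` for `|v| < D + 1`, independent of the
base point for `D < |v|`, and equal to `√(A + B v²)` for `D + 2 < |v|`. -/
structure IsTwistLagrangian (H L : T2 → ℝ → ℝ) (D A B : ℝ) : Prop where
  D_pos : 0 < D
  A_pos : 0 < A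
  B_pos : 0 < B
  smooth : ContDiff ℝ ∞ (lift L)
  convex : ∀ z v, 0 < deriv (deriv (L z)) v
  pos : ∀ z v, 0 < L z v
  eq_fibreLegendre : ∀ p v, |v| < D + 1 → L (projT p) v = fibreLegendre (lift H) (p, v)
  eq_of_lt_abs : ∀ z z' v, D < |v| → L z v = L z' v
  eq_sqrt : ∀ z v, D + 2 < |v| → L z v = √(A + B * v ^ 2)

lemma hasDerivAt_sqrt_quadratic {A B : ℝ} (hA : 0 < A) (hB : 0 < B) (w : ℝ) :
    HasDerivAt (fun y => √(A + B * y ^ 2)) (B * w / √(A + B * w ^ 2)) w := by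
  have hpos : 0 < A + B * w ^ 2 := by positivity
  have hquad : HasDerivAt (fun y : ℝ => A + B * y ^ 2) (B * (2 * w)) w := by
    simpa using ((hasDerivAt_pow 2 w).const_mul B).const_add A
  refine (hquad.sqrt hpos.ne').congr_deriv ?_
  field_simp

/- The tangent to `√(A + B y²)` at `w` has the value `(A + B w v) / √(A + B w²)` at `v`. -/
lemma pos_of_eventuallyEq_sqrt {A B : ℝ} (hA : 0 < A) (hB : 0 < B) {g : ℝ → ℝ}
    (hg : ContDiff ℝ 2 g) (hg'' : ∀ y, 0 < deriv (deriv g) y) {v w : ℝ} (hvw : 0 ≤ w * v)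
    (hsqrt : g =ᶠ[𝓝 w] fun y => √(A + B * y ^ 2)) : 0 < g v := by
  have hpos : 0 < A + B * w ^ 2 := by positivity
  calc 0 < (A + B * (w * v)) / √(A + B * w ^ 2) := by positivity
    _ = √(A + B * w ^ 2) + B * w / √(A + B * w ^ 2) * (v - w) := by
      field_simp
      rw [Real.sq_sqrt hpos.le]
      ring
    _ = g w + deriv g w * (v - w) := by
      rw [hsqrt.deriv_eq, (hasDerivAt_sqrt_quadratic hA hB w).deriv, hsqrt.eq_of_nhds]
    _ ≤ g v := add_deriv_mul_sub_le hg hg'' w v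

section ModifiedLagrangian

variable {H : T2 → ℝ → ℝ} {D Dp Dm : ℝ} {hp hm : ℝ → ℝ}

lemma modifiedLagrangian_of_lt (hD : 0 < D) (z : T2) {v : ℝ} (hv : D < v) :
    modifiedLagrangian H D hp hm z v = hp v := by
  rw [modifiedLagrangian, if_neg (by linarith), if_neg (by linarith)]

lemma modifiedLagrangian_of_lt_neg (z : T2) {v : ℝ} (hv : v < -D) :
    modifiedLagrangian H D hp hm z v = hm v :=
  if_pos hv

lemma modifiedLagrangian_projT (hD : 0 < D) (hH : IsConvexHamiltonian H D Dp Dm)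
    (hp_inner : ∀ y, y < D + 1 → hp y = y ^ 2 / 2 - Dp)
    (hm_inner : ∀ y, -D - 1 < y → hm y = y ^ 2 / 2 - Dm) (p : ℝ × ℝ) {v : ℝ}
    (hv : |v| < D + 1) :
    modifiedLagrangian H D hp hm (projT p) v = fibreLegendre (lift H) (p, v) := by
  rw [abs_lt] at hv
  rcases lt_or_ge v (-D) with hv_lt | hv_ge
  · rw [modifiedLagrangian_of_lt_neg _ hv_lt, hm_inner _ (by linarith),
      hH.fibreLegendre_of_lt_neg p hv_lt]
  rcases lt_or_ge D v with hv_gt | hv_le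
  · rw [modifiedLagrangian_of_lt hD _ hv_gt, hp_inner _ hv.2, hH.fibreLegendre_of_lt p hv_gt]
  · rw [modifiedLagrangian, if_neg (not_lt.2 hv_ge), if_pos hv_le, hH.legendreDual_projT]

variable (hD : 0 < D) (hH : IsConvexHamiltonian H D Dp Dm)
  (hp_inner : ∀ y, y < D + 1 → hp y = y ^ 2 / 2 - Dp)
  (hm_inner : ∀ y, -D - 1 < y → hm y = y ^ 2 / 2 - Dm)
include hD hH hp_inner hm_inner

lemma contDiff_lift_modifiedLagrangian (hp_smooth : ContDiff ℝ ∞ hp)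
    (hm_smooth : ContDiff ℝ ∞ hm) : ContDiff ℝ ∞ (lift (modifiedLagrangian H D hp hm)) := by
  refine contDiff_iff_contDiffAt.2 fun q => ?_
  rcases lt_or_ge |q.2| (D + 1) with hq | hq
  · refine hH.isLegendreRegular_lift.contDiff_fibreLegendre.contDiffAt.congr_of_eventuallyEq ?_
    filter_upwards [continuous_snd.abs.continuousAt.eventually (gt_mem_nhds hq)] with r hr
    exact modifiedLagrangian_projT hD hH hp_inner hm_inner r.1 hr
  have hq' : D < |q.2| := by linarith
  rcases lt_abs.1 hq' with hq | hq
  · refine (hp_smooth.comp contDiff_snd).contDiffAt.congr_of_eventuallyEq ?_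
    filter_upwards [continuous_snd.continuousAt.eventually (lt_mem_nhds hq)] with r hr
    exact modifiedLagrangian_of_lt hD _ hr
  · refine (hm_smooth.comp contDiff_snd).contDiffAt.congr_of_eventuallyEq ?_
    filter_upwards [continuous_snd.continuousAt.eventually (gt_mem_nhds (lt_neg.1 hq))] with r hr
    exact modifiedLagrangian_of_lt_neg _ hr

lemma deriv_deriv_modifiedLagrangian_pos (hp_convex : ∀ y, 0 < deriv (deriv hp) y)
    (hm_convex : ∀ y, 0 < deriv (deriv hm) y) (z : T2) (v : ℝ) :
    0 < deriv (deriv (modifiedLagrangian H D hp hm z)) v := by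
  rcases lt_or_ge |v| (D + 1) with hv | hv
  · obtain ⟨p, rfl⟩ := projT_surjective z
    have hlegendre : modifiedLagrangian H D hp hm (projT p) =ᶠ[𝓝 v]
        fun w => fibreLegendre (lift H) (p, w) :=
      (continuous_abs.continuousAt.eventually (gt_mem_nhds hv)).mono fun w =>
        modifiedLagrangian_projT hD hH hp_inner hm_inner p
    rw [hlegendre.deriv.deriv_eq]
    exact hH.isLegendreRegular_lift.deriv_deriv_fibreLegendre_pos p v
  have hv' : D < |v| := by linarith
  rcases lt_abs.1 hv' with hv | hv
  · have heq : modifiedLagrangian H D hp hm z =ᶠ[𝓝 v] hp :=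
      (lt_mem_nhds hv).mono fun w => modifiedLagrangian_of_lt hD z
    exact heq.deriv.deriv_eq ▸ hp_convex v
  · have heq : modifiedLagrangian H D hp hm z =ᶠ[𝓝 v] hm :=
      (gt_mem_nhds (lt_neg.1 hv)).mono fun w => modifiedLagrangian_of_lt_neg z
    exact heq.deriv.deriv_eq ▸ hm_convex v

lemma isTwistLagrangian_modifiedLagrangian {A B : ℝ} (hA : 0 < A) (hB : 0 < B)
    (hp_smooth : ContDiff ℝ ∞ hp) (hm_smooth : ContDiff ℝ ∞ hm)
    (hp_convex : ∀ y, 0 < deriv (deriv hp) y) (hm_convex : ∀ y, 0 < deriv (deriv hm) y)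
    (hp_outer : ∀ y, D + 2 < y → hp y = √(A + B * y ^ 2))
    (hm_outer : ∀ y, y < -D - 2 → hm y = √(A + B * y ^ 2)) :
    IsTwistLagrangian H (modifiedLagrangian H D hp hm) D A B := by
  have hsmooth := contDiff_lift_modifiedLagrangian hD hH hp_inner hm_inner hp_smooth hm_smooth
  have hconvex := deriv_deriv_modifiedLagrangian_pos hD hH hp_inner hm_inner hp_convex hm_convex
  have hsqrt : ∀ z v, D + 2 < |v| → modifiedLagrangian H D hp hm z v = √(A + B * v ^ 2) := by
    intro z v hv
    rcases lt_abs.1 hv with hv | hv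
    · rw [modifiedLagrangian_of_lt hD z (by linarith), hp_outer v hv]
    · rw [modifiedLagrangian_of_lt_neg z (by linarith), hm_outer v (by linarith)]
  refine ⟨hD, hA, hB, hsmooth, hconvex, fun z v => ?_, fun p v => modifiedLagrangian_projT hD hH
    hp_inner hm_inner p, fun z z' v hv => ?_, hsqrt⟩
  · obtain ⟨w, hvw, hw⟩ : ∃ w, 0 ≤ w * v ∧ D + 2 < |w| := by
      rcases le_total 0 v with hv | hv
      · exact ⟨D + 3, by positivity, by rw [abs_of_pos] <;> linarith⟩
      · exact ⟨-(D + 3), by nlinarith, by rw [abs_neg, abs_of_pos] <;> linarith⟩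
    obtain ⟨p, rfl⟩ := projT_surjective z
    have hfibre : ContDiff ℝ 2 (modifiedLagrangian H D hp hm (projT p)) :=
      (hsmooth.comp (contDiff_const.prodMk contDiff_id)).of_le (by norm_cast)
    exact pos_of_eventuallyEq_sqrt hA hB hfibre (hconvex _) hvw
      ((continuous_abs.continuousAt.eventually (lt_mem_nhds hw)).mono fun u => hsqrt _ u)
  · rcases lt_abs.1 hv with hv | hv
    · rw [modifiedLagrangian_of_lt hD z hv, modifiedLagrangian_of_lt hD z' hv]
    · rw [modifiedLagrangian_of_lt_neg z (lt_neg.1 hv),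
        modifiedLagrangian_of_lt_neg z' (lt_neg.1 hv)]

end ModifiedLagrangian

namespace IsTwistLagrangian

variable {H L : T2 → ℝ → ℝ} {D Dp Dm A B : ℝ} (hL : IsTwistLagrangian H L D A B)
include hL

lemma differentiable_lift : Differentiable ℝ (lift L) := hL.smooth.differentiable (by simp)

lemma contDiff_fibre (z : T2) : ContDiff ℝ ∞ (L z) := by
  obtain ⟨p, rfl⟩ := projT_surjective z
  exact hL.smooth.comp (contDiff_const.prodMk contDiff_id)

lemma fderiv_lift_of_abs_lt {q : (ℝ × ℝ) × ℝ} (hq : |q.2| < D + 1) :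
    fderiv ℝ (lift L) q = fderiv ℝ (fibreLegendre (lift H)) q :=
  EventuallyEq.fderiv_eq <|
    (continuous_snd.abs.continuousAt.eventually (gt_mem_nhds hq)).mono fun r =>
      hL.eq_fibreLegendre r.1 r.2

lemma velocity_lift_of_abs_lt (hH : IsLegendreRegular (lift H)) {q : (ℝ × ℝ) × ℝ}
    (hq : |q.2| < D + 1) : velocity (lift L) q = momentum (lift H) q := by
  rw [velocity, hL.fderiv_lift_of_abs_lt hq, hH.fderiv_fibreLegendre, Prod.mk_zero_zero, map_zero]
  ring

lemma fderiv_lift_position_of_abs_lt (hH : IsLegendreRegular (lift H)) {q : (ℝ × ℝ) × ℝ}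
    (hq : |q.2| < D + 1) : fderiv ℝ (lift L) q ((0, 1), 0) =
      -fderiv ℝ (lift H) (q.1, momentum (lift H) q) ((0, 1), 0) := by
  rw [hL.fderiv_lift_of_abs_lt hq, hH.fderiv_fibreLegendre]
  ring

lemma isHamiltonSolution_momentum (hH : IsLegendreRegular (lift H)) {θ : ℝ → ℝ}
    (hθ : IsEulerLagrange (fun t x v => L (projT (t, x)) v) θ) (hlt : ∀ t, |deriv θ t| < D + 1) :
    IsHamiltonSolution H θ fun t => momentum (lift H) ((t, θ t), deriv θ t) := by
  obtain ⟨hsmooth, hEL⟩ := (isEulerLagrange_lift_iff hL.differentiable_lift).1 hθ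
  refine (isHamiltonSolution_iff hH.differentiable).2 fun t => ⟨?_, ?_⟩
  · rw [hH.velocity_momentum]
    exact (hsmooth.differentiable (by simp) t).hasDerivAt
  · have hmom := hEL t
    rw [hL.fderiv_lift_position_of_abs_lt hH (hlt t)] at hmom
    exact hmom.congr_of_eventuallyEq <|
      Eventually.of_forall fun s => (hL.velocity_lift_of_abs_lt hH (hlt s)).symm

lemma isEulerLagrange_of_isHamiltonSolution (hH : IsLegendreRegular (lift H)) {θ y : ℝ → ℝ}
    (hθ : IsHamiltonSolution H θ y) (hlt : ∀ t, |deriv θ t| < D + 1) :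
    IsEulerLagrange (fun t x v => L (projT (t, x)) v) θ := by
  have hmom : ∀ t, momentum (lift H) ((t, θ t), deriv θ t) = y t := fun t =>
    hH.velocity_eq_iff.1 (hθ.deriv_position hH.smooth t).symm
  refine (isEulerLagrange_lift_iff hL.differentiable_lift).2
    ⟨hθ.contDiff_position hH.smooth, fun t => ?_⟩
  rw [hL.fderiv_lift_position_of_abs_lt hH (hlt t), hmom]
  refine (((isHamiltonSolution_iff hH.differentiable).1 hθ) t).2.congr_of_eventuallyEq ?_
  exact Eventually.of_forall fun s => (hL.velocity_lift_of_abs_lt hH (hlt s)).trans (hmom s)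

lemma deriv_eq_of_lt_abs {θ : ℝ → ℝ} (hθ : IsEulerLagrange (fun t x v => L (projT (t, x)) v) θ)
    {t₀ : ℝ} (ht₀ : D < |deriv θ t₀|) (t : ℝ) : deriv θ t = deriv θ t₀ := by
  have hfibre : ContDiff ℝ 2 (L 0) := (hL.contDiff_fibre 0).of_le (by norm_cast)
  refine hθ.deriv_eq_of_mem (isOpen_lt continuous_const continuous_abs)
    (fun t x v hv => hL.eq_of_lt_abs _ 0 v hv) hfibre.contDiffOn (fun v _ w hw => ?_) ht₀ t
  rw [fderiv_fderiv_apply_real hfibre]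
  exact mul_pos (by positivity) (hL.convex 0 v)

lemma isEulerLagrange_iff_exists_isHamiltonSolution (hH : IsConvexHamiltonian H D Dp Dm)
    {θ : ℝ → ℝ} : IsEulerLagrange (fun t x v => L (projT (t, x)) v) θ ↔
      ∃ y, IsHamiltonSolution H θ y := by
  have hreg := hH.isLegendreRegular_lift
  constructor
  · intro hθ
    by_cases hout : ∃ t₀, D < |deriv θ t₀|
    · obtain ⟨t₀, ht₀⟩ := hout
      refine ⟨fun _ => deriv θ t₀, (isHamiltonSolution_iff hH.differentiable_lift).2 fun t => ?_⟩
      rw [hH.velocity_of_lt_abs _ ht₀, hH.fderiv_lift_position_of_lt_abs _ ht₀, neg_zero,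
        ← hL.deriv_eq_of_lt_abs hθ ht₀ t]
      exact ⟨(hθ.1.differentiable (by simp) t).hasDerivAt, hasDerivAt_const _ _⟩
    · push Not at hout
      exact ⟨_, hL.isHamiltonSolution_momentum hreg hθ fun t => by linarith [hout t]⟩
  · rintro ⟨y, hy⟩
    by_cases hout : ∃ t₀, D < |y t₀|
    · obtain ⟨t₀, ht₀⟩ := hout
      refine isEulerLagrange_of_hasDerivAt_const (isOpen_lt continuous_const continuous_abs)
        (fun t x v hv => hL.eq_of_lt_abs _ 0 v hv) ht₀ fun t => ?_
      refine ((isHamiltonSolution_iff hH.differentiable_lift).1 hy t).1.congr_deriv ?_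
      rw [hH.momentum_eq_of_lt_abs hy ht₀ t, hH.velocity_of_lt_abs _ ht₀]
    · push Not at hout
      refine hL.isEulerLagrange_of_isHamiltonSolution hreg hy fun t => ?_
      rw [hy.deriv_position hH.smooth]
      exact (hH.abs_velocity_le_iff.2 (hout t)).trans_lt (lt_add_one D)

end IsTwistLagrangian

/-! ### The metric of a twist Lagrangian -/

/-- The perspective `(v₁, v₂) ↦ v₁ ℓ(v₂ / v₁)` of a function `ℓ` of one variable. It is meaningful
for `v₁ ≠ 0` only; for `v₁ > 0` the metric `finslerOf A B L` is the perspective of `L`. -/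
def perspective (ℓ : ℝ → ℝ) (v : ℝ × ℝ) : ℝ := v.1 * ℓ (v.2 / v.1)

lemma hasFDerivAt_perspective {ℓ : ℝ → ℝ} {ℓ' : ℝ} {v : ℝ × ℝ} (hv : v.1 ≠ 0)
    (hℓ : HasDerivAt ℓ ℓ' (v.2 / v.1)) :
    HasFDerivAt (perspective ℓ) ((ℓ (v.2 / v.1) - v.2 / v.1 * ℓ') • ContinuousLinearMap.fst ℝ ℝ ℝ +
      ℓ' • ContinuousLinearMap.snd ℝ ℝ ℝ) v := by
  have hfst : HasFDerivAt (fun u : ℝ × ℝ => u.1) (ContinuousLinearMap.fst ℝ ℝ ℝ) v :=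
    hasFDerivAt_fst
  have hsnd : HasFDerivAt (fun u : ℝ × ℝ => u.2) (ContinuousLinearMap.snd ℝ ℝ ℝ) v :=
    hasFDerivAt_snd
  have hslope := hsnd.fun_mul ((hasDerivAt_inv hv).comp_hasFDerivAt v hfst)
  refine (hfst.fun_mul (hℓ.comp_hasFDerivAt v hslope)).congr_fderiv ?_
  ext <;> simp <;> field_simp
  ring

lemma contDiffAt_perspective {ℓ : ℝ → ℝ} {n : WithTop ℕ∞} (hℓ : ContDiff ℝ n ℓ) {v : ℝ × ℝ}
    (hv : v.1 ≠ 0) :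
    ContDiffAt ℝ n (perspective ℓ) v :=
  contDiffAt_fst.mul (hℓ.contDiffAt.comp v (contDiffAt_snd.div contDiffAt_fst hv))

lemma fderiv_fderiv_half_sq_perspective {ℓ : ℝ → ℝ} (hℓ : ContDiff ℝ 2 ℓ) {v : ℝ × ℝ}
    (hv : v.1 ≠ 0) (w : ℝ × ℝ) :
    fderiv ℝ (fderiv ℝ fun u => (1 / 2) * perspective ℓ u ^ 2) v w w =
      ((ℓ (v.2 / v.1) - v.2 / v.1 * deriv ℓ (v.2 / v.1)) * w.1 + deriv ℓ (v.2 / v.1) * w.2) ^ 2 +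
        ℓ (v.2 / v.1) * deriv (deriv ℓ) (v.2 / v.1) * (w.2 - v.2 / v.1 * w.1) ^ 2 := by
  have hℓ' : ∀ m, HasDerivAt ℓ (deriv ℓ m) m := fun m =>
    (hℓ.differentiable (by simp) m).hasDerivAt
  have hline : ∀ s : ℝ, HasDerivAt (fun s : ℝ => v + s • w) w s := fun s => by
    simpa using ((hasDerivAt_id s).smul_const w).const_add v
  have hv₀ : (v + (0 : ℝ) • w).1 ≠ 0 := by simpa using hv
  set m : ℝ → ℝ := fun s => (v + s • w).2 / (v + s • w).1
  have hm₀ : m 0 = v.2 / v.1 := by simp [m]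
  have hm : HasDerivAt m ((w.2 - v.2 / v.1 * w.1) / v.1) 0 := by
    have hfst : HasDerivAt (fun s : ℝ => (v + s • w).1) w.1 0 := (hline 0).fst
    have hsnd : HasDerivAt (fun s : ℝ => (v + s • w).2) w.2 0 := (hline 0).snd
    refine (hsnd.fun_div hfst hv₀).congr_deriv ?_
    simp only [zero_smul, add_zero]
    field_simp
  have hfirst : ∀ s, (v + s • w).1 ≠ 0 → HasDerivAt (fun s : ℝ => perspective ℓ (v + s • w))
      ((ℓ (m s) - m s * deriv ℓ (m s)) * w.1 + deriv ℓ (m s) * w.2) s := fun s hs => by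
    refine ((hasFDerivAt_perspective hs (hℓ' _)).comp_hasDerivAt s (hline s)).congr_deriv ?_
    simp [m]
  have hsecond : HasDerivAt
      (fun s => (ℓ (m s) - m s * deriv ℓ (m s)) * w.1 + deriv ℓ (m s) * w.2)
      (deriv (deriv ℓ) (m 0) * (w.2 - v.2 / v.1 * w.1) ^ 2 / v.1) 0 := by
    have hderiv := (hasDerivAt_deriv_of_contDiff_two hℓ (m 0)).comp 0 hm
    refine (((((hℓ' (m 0)).comp 0 hm).sub (hm.mul hderiv)).mul_const w.1).add
      (hderiv.mul_const w.2)).congr_deriv ?_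
    simp only [Function.comp_apply, hm₀]
    ring
  have hne : ∀ᶠ s in 𝓝 (0 : ℝ), (v + s • w).1 ≠ 0 :=
    (hline 0).continuousAt.fst.eventually_ne hv₀
  refine fderiv_fderiv_apply_of_line
    (contDiffAt_const.mul ((contDiffAt_perspective hℓ hv).pow 2))
    (hne.mono fun s hs => (((hfirst s hs).fun_pow 2).const_mul (1 / 2)).congr_deriv ?_)
    (((hfirst 0 hv₀).fun_mul hsecond).congr_deriv ?_)
  · ring
  · simp only [hm₀, zero_smul, add_zero, perspective]
    field_simp

lemma fderiv_fderiv_half_sq_perspective_pos {ℓ : ℝ → ℝ} (hℓ : ContDiff ℝ 2 ℓ)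
    (hpos : ∀ m, 0 < ℓ m) (hconv : ∀ m, 0 < deriv (deriv ℓ) m) {v w : ℝ × ℝ} (hv : v.1 ≠ 0)
    (hw : w ≠ 0) : 0 < fderiv ℝ (fderiv ℝ fun u => (1 / 2) * perspective ℓ u ^ 2) v w w := by
  rw [fderiv_fderiv_half_sq_perspective hℓ hv]
  have hcoeff := mul_pos (hpos (v.2 / v.1)) (hconv (v.2 / v.1))
  rcases eq_or_ne (w.2 - v.2 / v.1 * w.1) 0 with hparallel | htransverse
  · have hw₂ : w.2 = v.2 / v.1 * w.1 := sub_eq_zero.1 hparallel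
    have hw₁ : w.1 ≠ 0 := fun hzero => hw (Prod.ext hzero (by rw [hw₂, hzero, mul_zero]; rfl))
    have hradial : (ℓ (v.2 / v.1) - v.2 / v.1 * deriv ℓ (v.2 / v.1)) * w.1 +
        deriv ℓ (v.2 / v.1) * w.2 = ℓ (v.2 / v.1) * w.1 := by rw [hw₂]; ring
    have := (hpos (v.2 / v.1)).ne'
    rw [hradial]
    positivity
  · positivity

lemma fderiv_fderiv_half_quadratic (A B : ℝ) (v w : ℝ × ℝ) :
    fderiv ℝ (fderiv ℝ fun u : ℝ × ℝ => (1 / 2) * (A * u.1 ^ 2 + B * u.2 ^ 2)) v w w =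
      A * w.1 ^ 2 + B * w.2 ^ 2 := by
  have hfst : ∀ s : ℝ, HasDerivAt (fun s : ℝ => (v + s • w).1) w.1 s := fun s => by
    simpa using ((hasDerivAt_id s).mul_const w.1).const_add v.1
  have hsnd : ∀ s : ℝ, HasDerivAt (fun s : ℝ => (v + s • w).2) w.2 s := fun s => by
    simpa using ((hasDerivAt_id s).mul_const w.2).const_add v.2
  refine fderiv_fderiv_apply_of_line (by fun_prop)
    (g := fun s => A * (v + s • w).1 * w.1 + B * (v + s • w).2 * w.2)
    (Eventually.of_forall fun s => ?_) ?_
  · refine (((((hfst s).fun_pow 2).const_mul A).add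
      (((hsnd s).fun_pow 2).const_mul B)).const_mul (1 / 2)).congr_deriv ?_
    ring
  · refine ((((hfst 0).const_mul A).mul_const w.1).add
      (((hsnd 0).const_mul B).mul_const w.2)).congr_deriv ?_
    ring

lemma quadratic_pos {A B : ℝ} (hA : 0 < A) (hB : 0 < B) {v : ℝ × ℝ} (hv : v ≠ 0) :
    0 < A * v.1 ^ 2 + B * v.2 ^ 2 := by
  rcases eq_or_ne v.1 0 with hv₁ | hv₁
  · have hv₂ : v.2 ≠ 0 := fun hv₂ => hv (Prod.ext hv₁ hv₂)
    positivity
  · positivity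

/-- The set of velocities outside the cone `|v₂| ≤ d v₁`. For `d = D` the metric does not depend on
the base point there, for `d = D + 2` it is `√(A v₁² + B v₂²)`. -/
def outerCone (d : ℝ) : Set (ℝ × ℝ) := {v | d * v.1 < |v.2|}

lemma isOpen_outerCone (d : ℝ) : IsOpen (outerCone d) :=
  isOpen_lt (by fun_prop) (by fun_prop)

lemma mem_outerCone_iff {d : ℝ} {v : ℝ × ℝ} (hv : 0 < v.1) :
    v ∈ outerCone d ↔ d < |v.2 / v.1| := by
  rw [abs_div, abs_of_pos hv, lt_div_iff₀ hv]
  rfl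

lemma mem_outerCone_of_nonpos {d : ℝ} (hd : 0 < d) {v : ℝ × ℝ} (hv : v ≠ 0) (hv₁ : v.1 ≤ 0) :
    v ∈ outerCone d := by
  rcases hv₁.eq_or_lt with hzero | hneg
  · have hv₂ : v.2 ≠ 0 := fun hv₂ => hv (Prod.ext hzero hv₂)
    simpa [outerCone, hzero] using hv₂
  · exact (mul_neg_of_pos_of_neg hd hneg).trans_le (abs_nonneg _)

section FinslerOf

variable {L : T2 → ℝ → ℝ} {A B : ℝ}

lemma finslerOf_of_pos (z : T2) {v : ℝ × ℝ} (hv : 0 < v.1) :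
    finslerOf A B L z v = perspective (L z) v :=
  if_pos hv

lemma finslerOf_of_nonpos (z : T2) {v : ℝ × ℝ} (hv : v.1 ≤ 0) :
    finslerOf A B L z v = √(A * v.1 ^ 2 + B * v.2 ^ 2) :=
  if_neg hv.not_gt

lemma finslerOf_eventuallyEq_of_pos (z : T2) {v : ℝ × ℝ} (hv : 0 < v.1) :
    finslerOf A B L z =ᶠ[𝓝 v] perspective (L z) :=
  (continuous_fst.continuousAt.eventually (lt_mem_nhds hv)).mono fun _ => finslerOf_of_pos z

lemma finslerOf_smul (z : T2) (v : ℝ × ℝ) {r : ℝ} (hr : 0 < r) :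
    finslerOf A B L z (r • v) = r * finslerOf A B L z v := by
  rcases le_or_gt v.1 0 with hv | hv
  · have hquad : A * (r • v).1 ^ 2 + B * (r • v).2 ^ 2 = r ^ 2 * (A * v.1 ^ 2 + B * v.2 ^ 2) := by
      simp only [Prod.smul_fst, Prod.smul_snd, smul_eq_mul]
      ring
    rw [finslerOf_of_nonpos z hv,
      finslerOf_of_nonpos z (mul_nonpos_of_nonneg_of_nonpos hr.le hv : (r • v).1 ≤ 0), hquad,
      Real.sqrt_mul (sq_nonneg r), Real.sqrt_sq hr.le]
  · rw [finslerOf_of_pos z hv, finslerOf_of_pos z (mul_pos hr hv : 0 < (r • v).1), perspective,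
      perspective, Prod.smul_fst, Prod.smul_snd, smul_eq_mul, smul_eq_mul,
      mul_div_mul_left _ _ hr.ne', mul_assoc]

end FinslerOf

namespace IsTwistLagrangian

variable {H L : T2 → ℝ → ℝ} {D A B : ℝ} (hL : IsTwistLagrangian H L D A B)
include hL

lemma finslerOf_eq_sqrt (z : T2) {v : ℝ × ℝ} (hv : v ∈ outerCone (D + 2)) :
    finslerOf A B L z v = √(A * v.1 ^ 2 + B * v.2 ^ 2) := by
  rcases le_or_gt v.1 0 with hv₁ | hv₁
  · exact finslerOf_of_nonpos z hv₁
  rw [finslerOf_of_pos z hv₁, perspective, hL.eq_sqrt z _ ((mem_outerCone_iff hv₁).1 hv)]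
  nth_rewrite 1 [← Real.sqrt_sq hv₁.le]
  rw [← Real.sqrt_mul (sq_nonneg _)]
  congr 1
  field_simp

lemma finslerOf_eq_of_mem_outerCone (z z' : T2) {v : ℝ × ℝ} (hv : v ∈ outerCone D) :
    finslerOf A B L z v = finslerOf A B L z' v := by
  rcases le_or_gt v.1 0 with hv₁ | hv₁
  · rw [finslerOf_of_nonpos z hv₁, finslerOf_of_nonpos z' hv₁]
  · rw [finslerOf_of_pos z hv₁, finslerOf_of_pos z' hv₁, perspective, perspective,
      hL.eq_of_lt_abs z z' _ ((mem_outerCone_iff hv₁).1 hv)]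

lemma finslerOf_pos (z : T2) {v : ℝ × ℝ} (hv : v ≠ 0) : 0 < finslerOf A B L z v := by
  rcases le_or_gt v.1 0 with hv₁ | hv₁
  · rw [finslerOf_of_nonpos z hv₁]
    exact Real.sqrt_pos.2 (quadratic_pos hL.A_pos hL.B_pos hv)
  · rw [finslerOf_of_pos z hv₁]
    exact mul_pos hv₁ (hL.pos _ _)

lemma contDiffAt_finslerOf {w : (ℝ × ℝ) × (ℝ × ℝ)} (hw : w.2 ≠ 0) :
    ContDiffAt ℝ ∞ (fun w : (ℝ × ℝ) × (ℝ × ℝ) => finslerOf A B L (projT w.1) w.2) w := by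
  rcases le_or_gt w.2.1 0 with hw₁ | hw₁
  · have hsqrt : ContDiffAt ℝ ∞
        (fun w : (ℝ × ℝ) × (ℝ × ℝ) => √(A * w.2.1 ^ 2 + B * w.2.2 ^ 2)) w :=
      ContDiffAt.sqrt (by fun_prop) (quadratic_pos hL.A_pos hL.B_pos hw).ne'
    have hout := mem_outerCone_of_nonpos (by linarith [hL.D_pos] : 0 < D + 2) hw hw₁
    refine hsqrt.congr_of_eventuallyEq ?_
    filter_upwards [continuous_snd.continuousAt.eventually
      ((isOpen_outerCone _).mem_nhds hout)] with u hu using hL.finslerOf_eq_sqrt _ hu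
  · have hslope : ContDiffAt ℝ ∞ (fun w : (ℝ × ℝ) × (ℝ × ℝ) => w.2.2 / w.2.1) w :=
      ContDiffAt.div (by fun_prop) (by fun_prop) hw₁.ne'
    have hperspective : ContDiffAt ℝ ∞ (fun w : (ℝ × ℝ) × (ℝ × ℝ) =>
        w.2.1 * lift L (w.1, w.2.2 / w.2.1)) w :=
      ContDiffAt.mul (by fun_prop) (hL.smooth.contDiffAt.comp w (contDiffAt_fst.prodMk hslope))
    refine hperspective.congr_of_eventuallyEq ?_
    filter_upwards [continuous_snd.fst.continuousAt.eventually (lt_mem_nhds hw₁)] with u hu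
      using finslerOf_of_pos _ hu

lemma fderiv_fderiv_half_sq_finslerOf_pos (z : T2) {v w : ℝ × ℝ} (hv : v ≠ 0) (hw : w ≠ 0) :
    0 < fderiv ℝ (fderiv ℝ fun u => (1 / 2) * finslerOf A B L z u ^ 2) v w w := by
  rcases le_or_gt v.1 0 with hv₁ | hv₁
  · have hout := mem_outerCone_of_nonpos (by linarith [hL.D_pos] : 0 < D + 2) hv hv₁
    have hsqrt : (fun u => (1 / 2) * finslerOf A B L z u ^ 2) =ᶠ[𝓝 v]
        fun u => (1 / 2) * (A * u.1 ^ 2 + B * u.2 ^ 2) := by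
      filter_upwards [(isOpen_outerCone _).mem_nhds hout] with u hu
      have := hL.A_pos
      have := hL.B_pos
      rw [hL.finslerOf_eq_sqrt z hu, Real.sq_sqrt (by positivity)]
    rw [hsqrt.fderiv.fderiv_eq, fderiv_fderiv_half_quadratic]
    exact quadratic_pos hL.A_pos hL.B_pos hw
  · have hperspective : (fun u => (1 / 2) * finslerOf A B L z u ^ 2) =ᶠ[𝓝 v]
        fun u => (1 / 2) * perspective (L z) u ^ 2 :=
      (finslerOf_eventuallyEq_of_pos z hv₁).mono fun u hu =>
        congrArg (fun r => (1 / 2) * r ^ 2) hu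
    rw [hperspective.fderiv.fderiv_eq]
    exact fderiv_fderiv_half_sq_perspective_pos ((hL.contDiff_fibre z).of_le (by norm_cast))
      (hL.pos z) (hL.convex z) hv₁.ne' hw

lemma isFinsler_finslerOf : IsFinsler (finslerOf A B L) where
  nonneg z v := by
    rcases eq_or_ne v 0 with rfl | hv
    · rw [finslerOf_of_nonpos z le_rfl]
      exact Real.sqrt_nonneg _
    · exact (hL.finslerOf_pos z hv).le
  smooth _ hw := (hL.contDiffAt_finslerOf hw).contDiffWithinAt
  homogeneous z v _ hr := finslerOf_smul z v hr
  strongly_convex z _ hv _ hw := hL.fderiv_fderiv_half_sq_finslerOf_pos z hv hw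

end IsTwistLagrangian

/-! ### Geodesics -/

/-- The energy `F² / 2` of a metric on the torus, lifted to the universal covering. -/
def energy (F : T2 → ℝ × ℝ → ℝ) (w : (ℝ × ℝ) × (ℝ × ℝ)) : ℝ := (1 / 2) * F (projT w.1) w.2 ^ 2

/-- `c` is the lift to the universal covering of a geodesic of `F`, of constant speed. -/
def IsGeodesic (F : T2 → ℝ × ℝ → ℝ) (c : ℝ → ℝ × ℝ) : Prop :=
  IsEulerLagrange (fun _ x v => energy F (x, v)) c

section Geodesics

variable {F : T2 → ℝ × ℝ → ℝ}

lemma fderiv_energy_fibre {x v : ℝ × ℝ} (h : DifferentiableAt ℝ (energy F) (x, v)) :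
    fderiv ℝ (fun v => energy F (x, v)) v =
      (fderiv ℝ (energy F) (x, v)).comp (.inr ℝ (ℝ × ℝ) (ℝ × ℝ)) :=
  (h.hasFDerivAt.comp v (hasFDerivAt_prodMk_right x v)).fderiv

lemma fderiv_energy_base {x v : ℝ × ℝ} (h : DifferentiableAt ℝ (energy F) (x, v)) :
    fderiv ℝ (fun x => energy F (x, v)) x =
      (fderiv ℝ (energy F) (x, v)).comp (.inl ℝ (ℝ × ℝ) (ℝ × ℝ)) :=
  (HasFDerivAt.comp (f := fun x => (x, v)) x h.hasFDerivAt (hasFDerivAt_prodMk_left x v)).fderiv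

namespace IsFinsler

variable (hF : IsFinsler F)
include hF

lemma map_zero (z : T2) : F z 0 = 0 := by
  have h := hF.homogeneous z 0 2 two_pos
  rw [smul_zero] at h
  linarith

lemma ne_zero_of_eq_one {z : T2} {v : ℝ × ℝ} (hv : F z v = 1) : v ≠ 0 := by
  rintro rfl
  exact zero_ne_one ((hF.map_zero z).symm.trans hv)

lemma differentiableAt_energy (x : ℝ × ℝ) {v : ℝ × ℝ} (hv : v ≠ 0) :
    DifferentiableAt ℝ (energy F) (x, v) := by
  have hopen : IsOpen {w : (ℝ × ℝ) × (ℝ × ℝ) | w.2 ≠ 0} := isOpen_ne.preimage continuous_snd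
  have hsmooth := hF.smooth.contDiffAt (hopen.mem_nhds (show (x, v) ∈ _ from hv))
  exact (contDiffAt_const.mul (hsmooth.pow 2)).differentiableAt (by simp)

-- Euler's relation for a function homogeneous of degree two.
lemma fderiv_energy_self (x v : ℝ × ℝ) :
    fderiv ℝ (fun v => energy F (x, v)) v v = F (projT x) v ^ 2 := by
  rcases eq_or_ne v 0 with rfl | hv
  · rw [hF.map_zero, _root_.map_zero, zero_pow two_ne_zero]
  have hray : HasDerivAt (fun r : ℝ => r • v) v 1 := by
    simpa using (hasDerivAt_id (1 : ℝ)).smul_const v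
  have hfibre : DifferentiableAt ℝ (fun v => energy F (x, v)) v :=
    (hF.differentiableAt_energy x hv).comp v (by fun_prop)
  have hsquare : HasDerivAt (fun r : ℝ => (1 / 2) * (r * F (projT x) v) ^ 2)
      (F (projT x) v ^ 2) 1 := by
    refine ((((hasDerivAt_id' (1 : ℝ)).mul_const (F (projT x) v)).fun_pow 2).const_mul
      (1 / 2)).congr_deriv ?_
    ring
  refine (hfibre.hasFDerivAt.comp_hasDerivAt_of_eq (1 : ℝ) hray (one_smul ℝ v).symm).unique
    (hsquare.congr_of_eventuallyEq ?_)
  filter_upwards [lt_mem_nhds (zero_lt_one' ℝ)] with r hr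
  rw [Function.comp_apply, energy, hF.homogeneous _ _ r hr]

end IsFinsler

namespace IsGeodesic

variable {c : ℝ → ℝ × ℝ} (hc : IsGeodesic F c)
include hc

lemma hasDerivAt (t : ℝ) : HasDerivAt c (deriv c t) t :=
  (hc.1.differentiable (by simp) t).hasDerivAt

lemma continuous_deriv : Continuous (deriv c) := hc.1.continuous_deriv (by simp)

lemma add_const {k : ℝ × ℝ} (hk : projT k = 0) : IsGeodesic F (fun t => c t + k) := by
  have hderiv : deriv (fun t => c t + k) = deriv c := funext fun t => deriv_add_const k
  have henergy : ∀ x v, energy F (x + k, v) = energy F (x, v) := fun x v => by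
    rw [energy, energy, projT_add_of_eq_zero hk]
  refine ⟨hc.1.add contDiff_const, fun t => ?_⟩
  rw [hderiv, ← fderiv_comp_add_right]
  simp only [henergy]
  exact hc.2 t

lemma hasDerivAt_sq_speed (hF : IsFinsler F) {t : ℝ} (ht : deriv c t ≠ 0) :
    HasDerivAt (fun s => F (projT (c s)) (deriv c s) ^ 2) 0 t := by
  have hdiff := hF.differentiableAt_energy (c t) ht
  have hacc := hasDerivAt_deriv_of_contDiff_two hc.1 t
  have henergy := hdiff.hasFDerivAt.comp_hasDerivAt t ((hc.hasDerivAt t).prodMk hacc)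
  have hEuler := (hc.2 t).clm_apply hacc
  simp only [hF.fderiv_energy_self, fderiv_energy_base hdiff, fderiv_energy_fibre hdiff] at hEuler
  have hsplit : fderiv ℝ (energy F) (c t, deriv c t) (deriv c t, deriv (deriv c) t) =
      fderiv ℝ (energy F) (c t, deriv c t) (deriv c t, 0) +
        fderiv ℝ (energy F) (c t, deriv c t) (0, deriv (deriv c) t) := by
    rw [← map_add, Prod.mk_add_mk, add_zero, zero_add]
  -- The square of the speed is both twice the energy and the momentum paired with the velocity.
  have htwice := ((henergy.const_mul 2).congr_of_eventuallyEq (Eventually.of_forall fun s =>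
    show F (projT (c s)) (deriv c s) ^ 2 = 2 * (1 / 2 * _) by ring)).unique hEuler
  rw [hsplit] at htwice
  refine hEuler.congr_deriv ?_
  simp only [ContinuousLinearMap.comp_apply, ContinuousLinearMap.inl_apply,
    ContinuousLinearMap.inr_apply] at htwice ⊢
  linarith

lemma speed_eq (hF : IsFinsler F) (t t' : ℝ) :
    F (projT (c t)) (deriv c t) = F (projT (c t')) (deriv c t') := by
  set g : ℝ → ℝ := fun s => F (projT (c s)) (deriv c s) ^ 2 with hg
  have hcont : Continuous g := by
    simp only [hg, ← hF.fderiv_energy_self]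
    exact (continuous_iff_continuousAt.2 fun s => (hc.2 s).continuousAt).clm_apply
      hc.continuous_deriv
  have hderiv : ∀ s, g s ∈ ({0}ᶜ : Set ℝ) → HasDerivAt g 0 s := fun s hs =>
    hc.hasDerivAt_sq_speed hF fun hzero => hs (by simp [hg, hzero, hF.map_zero])
  have hsq : g t = g t' := by
    by_cases ht' : g t' = 0
    · by_cases ht : g t = 0
      · rw [ht, ht']
      · exact (eq_of_hasDerivAt_zero_of_mem hcont isOpen_compl_singleton hderiv ht t').symm
    · exact eq_of_hasDerivAt_zero_of_mem hcont isOpen_compl_singleton hderiv ht' t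
  exact (sq_eq_sq₀ (hF.nonneg _ _) (hF.nonneg _ _)).1 hsq

end IsGeodesic

lemma projTT_surjective : Function.Surjective projTT := fun u => by
  obtain ⟨p, hp⟩ := projT_surjective u.1
  exact ⟨(p, u.2), Prod.ext hp rfl⟩

lemma exists_geodesicFlow (hF : IsFinsler F)
    (hex : ∀ p v, F (projT p) v = 1 → ∃ c, IsGeodesic F c ∧ c 0 = p ∧ deriv c 0 = v)
    (huniq : ∀ c c', IsGeodesic F c → IsGeodesic F c' → F (projT (c 0)) (deriv c 0) = 1 →
      c 0 = c' 0 → deriv c 0 = deriv c' 0 → c = c') :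
    ∃ φ : ℝ → TT2 → TT2, IsGeodesicFlow F φ := by
  have hcurve : ∀ u ∈ unitTangent F, ∃ c, IsGeodesic F c ∧ projTT (c 0, deriv c 0) = u := by
    intro u hu
    obtain ⟨⟨p, v⟩, rfl⟩ := projTT_surjective u
    obtain ⟨c, hc, hp, hv⟩ := hex p v hu
    exact ⟨c, hc, by rw [hp, hv]⟩
  choose! γ hγ hγ₀ using hcurve
  have hone : ∀ u ∈ unitTangent F, F (projT (γ u 0)) (deriv (γ u) 0) = 1 := fun u hu => by
    rw [← hγ₀ u hu] at hu
    exact hu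
  refine ⟨fun t u => projTT (γ u t, deriv (γ u) t), fun t u hu =>
    ((hγ u hu).speed_eq hF t 0).trans (hone u hu), fun u hu δ =>
    ⟨?_, fun hδ => ⟨⟨γ u, hγ u hu, hδ⟩, (hδ 0).trans (hγ₀ u hu)⟩⟩⟩
  rintro ⟨⟨c, hc, hδ⟩, hδ₀⟩ t
  obtain ⟨hp, hv⟩ := Prod.ext_iff.1 ((hγ₀ u hu).trans (hδ₀.symm.trans (hδ 0)))
  simp only [projTT] at hp hv
  have hk : projT (γ u 0 - c 0) = 0 := by
    simpa [projT, sub_eq_zero, Prod.ext_iff] using hp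
  have hderiv : deriv (fun t => c t + (γ u 0 - c 0)) = deriv c :=
    funext fun t => deriv_add_const _
  have heq := huniq _ _ (hγ u hu) (IsGeodesic.add_const hc hk) (hone u hu) (by simp)
    (by rw [hderiv, hv])
  have hbase : projT (γ u t) = projT (c t) := by rw [heq, projT_add_of_eq_zero hk]
  rw [hδ t, ← hderiv, ← heq]
  exact Prod.ext hbase.symm rfl

end Geodesics

/-! ### The geodesic field -/

/-- The vector field on the extended phase space `{((t, x), y)}` whose integral curves are the unit
speed geodesics with `v₁ > 0`, together with the momenta `y` of their slopes. It is the suspended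
Hamiltonian field `(1, ∂_y H, -∂_x H)` divided by the speed `L` of its first two components. -/
def geodesicField (H L : T2 → ℝ → ℝ) (q : (ℝ × ℝ) × ℝ) : (ℝ × ℝ) × ℝ :=
  (lift L (q.1, velocity (lift H) q))⁻¹ •
    ((1, velocity (lift H) q), -fderiv ℝ (lift H) q ((0, 1), 0))

section GeodesicField

variable {H L : T2 → ℝ → ℝ}

lemma geodesicField_add_of_projT_eq_zero {k : ℝ × ℝ} (hk : projT k = 0) (q : (ℝ × ℝ) × ℝ) :
    geodesicField H L (q + (k, 0)) = geodesicField H L q := by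
  have hL := lift_add_of_projT_eq_zero (H := L) hk (q.1, velocity (lift H) q)
  rw [Prod.mk_add_mk, add_zero] at hL
  rw [geodesicField, velocity_add_of_projT_eq_zero hk, fderiv_lift_add_of_projT_eq_zero hk,
    Prod.fst_add, hL, geodesicField]

variable {γ : ℝ → (ℝ × ℝ) × ℝ} (hγ : IsIntegralCurve γ fun _ => geodesicField H L)
include hγ

lemma hasDerivAt_position_of_isIntegralCurve (t : ℝ) : HasDerivAt (fun t => (γ t).1)
    ((lift L ((γ t).1, velocity (lift H) (γ t)))⁻¹ • (1, velocity (lift H) (γ t))) t :=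
  (ContinuousLinearMap.fst ℝ (ℝ × ℝ) ℝ).hasFDerivAt.comp_hasDerivAt t (hγ t)

lemma hasDerivAt_momentum_of_isIntegralCurve (t : ℝ) : HasDerivAt (fun t => (γ t).2)
    ((lift L ((γ t).1, velocity (lift H) (γ t)))⁻¹ * -fderiv ℝ (lift H) (γ t) ((0, 1), 0)) t :=
  (ContinuousLinearMap.snd ℝ (ℝ × ℝ) ℝ).hasFDerivAt.comp_hasDerivAt t (hγ t)

-- Along the suspended Hamiltonian flow `H` changes only by its explicit dependence on time.
lemma hasDerivAt_lift_of_isIntegralCurve (hH : Differentiable ℝ (lift H)) (t : ℝ) :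
    HasDerivAt (fun t => lift H (γ t)) ((lift L ((γ t).1, velocity (lift H) (γ t)))⁻¹ *
      fderiv ℝ (lift H) (γ t) ((1, 0), 0)) t := by
  have hcomp : HasDerivAt (fun t => lift H (γ t))
      (fderiv ℝ (lift H) (γ t) (geodesicField H L (γ t))) t :=
    (hH (γ t)).hasFDerivAt.comp_hasDerivAt t (hγ t)
  have hsplit : geodesicField H L (γ t) = (lift L ((γ t).1, velocity (lift H) (γ t)))⁻¹ •
      (((1, 0), 0) + velocity (lift H) (γ t) • ((0, 1), 0) +
        -fderiv ℝ (lift H) (γ t) ((0, 1), 0) • (0, 1)) := by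
    simp [geodesicField]
  refine hcomp.congr_deriv ?_
  rw [hsplit, map_smul, map_add, map_add, map_smul, map_smul, smul_eq_mul, smul_eq_mul,
    smul_eq_mul, velocity]
  ring

lemma IsConvexHamiltonian.momentum_eq_of_isIntegralCurve {D Dp Dm : ℝ}
    (hH : IsConvexHamiltonian H D Dp Dm) {t₀ : ℝ} (ht₀ : D < |(γ t₀).2|) (t : ℝ) :
    (γ t).2 = (γ t₀).2 := by
  refine eq_of_hasDerivAt_zero_of_mem hγ.continuous.snd
    (isOpen_lt continuous_const continuous_abs) (fun s hs => ?_) ht₀ t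
  refine (hasDerivAt_momentum_of_isIntegralCurve hγ s).congr_deriv ?_
  rw [hH.fderiv_lift_position_of_lt_abs (γ s).1 hs, neg_zero, mul_zero]

end GeodesicField

namespace IsTwistLagrangian

variable {H L : T2 → ℝ → ℝ} {D Dp Dm A B : ℝ} (hL : IsTwistLagrangian H L D A B)
include hL

lemma contDiff_geodesicField (hH : ContDiff ℝ ∞ (lift H)) :
    ContDiff ℝ ∞ (geodesicField H L) := by
  have hvel := contDiff_velocity hH
  have hspeed : ContDiff ℝ ∞ fun q : (ℝ × ℝ) × ℝ => (lift L (q.1, velocity (lift H) q))⁻¹ :=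
    (hL.smooth.comp (contDiff_fst.prodMk hvel)).inv fun q => (hL.pos _ _).ne'
  exact hspeed.smul ((contDiff_const.prodMk hvel).prodMk
    ((hH.fderiv_right (m := ∞) (by simp)).clm_apply contDiff_const).neg)

variable (hH : IsConvexHamiltonian H D Dp Dm)
include hH

lemma geodesicField_of_lt_abs (p : ℝ × ℝ) {y : ℝ} (hy : D < |y|) :
    geodesicField H L (p, y) = (L 0 y)⁻¹ • ((1, y), 0) := by
  rw [geodesicField, hH.velocity_of_lt_abs p hy, hH.fderiv_lift_position_of_lt_abs p hy, neg_zero,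
    lift, hL.eq_of_lt_abs _ 0 y hy]

lemma exists_isIntegralCurve_geodesicField (q : (ℝ × ℝ) × ℝ) :
    ∃ γ, γ 0 = q ∧ IsIntegralCurve γ fun _ => geodesicField H L := by
  have hX : ContDiff ℝ 1 (geodesicField H L) :=
    (hL.contDiff_geodesicField hH.contDiff_lift).of_le (by norm_cast)
  have hbox : IsCompact (Icc (0 : ℝ × ℝ) 1 ×ˢ Icc (-D) D) := isCompact_Icc.prod isCompact_Icc
  obtain ⟨ε, hε, hlocal⟩ := exists_uniform_time_of_isCompact hX hbox
  refine exists_integralCurve_of_uniform_time hX hε (fun ⟨p, y⟩ => ?_) q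
  rcases lt_or_ge D |y| with hy | hy
  · have hfield := fun p => hL.geodesicField_of_lt_abs hH p hy
    refine ⟨fun t => (p, y) + t • (L 0 y)⁻¹ • ((1, y), 0), by simp, fun t _ => ?_⟩
    have hy_const : (p, y) + t • (L 0 y)⁻¹ • (((1, y), 0) : (ℝ × ℝ) × ℝ) =
        (p + t • (L 0 y)⁻¹ • (1, y), y) := by simp
    simp only [hy_const, hfield]
    simpa using (((hasDerivAt_id t).smul_const ((L 0 y)⁻¹ • ((1, y) : ℝ × ℝ))).const_add p).prodMk
      (hasDerivAt_const t y)
  · obtain ⟨k, hk, hmem⟩ := exists_projT_eq_zero_add_mem_Icc p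
    obtain ⟨γ, hγ₀, hγ⟩ := hlocal (p + k, y) ⟨hmem, abs_le.1 hy⟩
    refine ⟨fun t => γ t - (k, 0), by simp [hγ₀], fun t ht => ?_⟩
    rw [← geodesicField_add_of_projT_eq_zero hk, sub_add_cancel]
    exact (hγ t ht).sub_const _

end IsTwistLagrangian

/-! ### Geodesics of the metric of a twist Lagrangian -/

section UnitVelocity

variable {L : T2 → ℝ → ℝ} {A B : ℝ}

lemma finslerOf_inv_smul_one (hL : ∀ z v, 0 < L z v) (z : T2) (u : ℝ) :
    finslerOf A B L z ((L z u)⁻¹ • (1, u)) = 1 := by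
  rw [finslerOf_smul _ _ (inv_pos.2 (hL z u)), finslerOf_of_pos _ one_pos, perspective, one_mul,
    div_one, inv_mul_cancel₀ (hL z u).ne']

lemma eq_inv_smul_one_of_finslerOf_eq_one {z : T2} {v : ℝ × ℝ} (hv : 0 < v.1)
    (hone : finslerOf A B L z v = 1) : v = (L z (v.2 / v.1))⁻¹ • (1, v.2 / v.1) := by
  have hone : v.1 * L z (v.2 / v.1) = 1 := (finslerOf_of_pos _ hv).symm.trans hone
  rw [← eq_inv_of_mul_eq_one_left hone, Prod.smul_mk, smul_eq_mul, smul_eq_mul, mul_one,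
    mul_div_cancel₀ _ hv.ne']

lemma snd_div_fst_smul_one {r : ℝ} (hr : r ≠ 0) (u : ℝ) :
    (r • ((1, u) : ℝ × ℝ)).2 / (r • ((1, u) : ℝ × ℝ)).1 = u := by
  simp [hr]

lemma pos_of_notMem_outerCone {d : ℝ} (hd : 0 < d) {v : ℝ × ℝ} (hv : v ≠ 0)
    (hv' : v ∉ outerCone d) : 0 < v.1 :=
  not_le.1 fun hv₁ => hv' (mem_outerCone_of_nonpos hd hv hv₁)

end UnitVelocity

namespace IsTwistLagrangian

variable {H L : T2 → ℝ → ℝ} {D Dp Dm A B : ℝ} (hL : IsTwistLagrangian H L D A B)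
include hL

local notation "𝓕" => finslerOf A B L

section Energy

variable (hH : IsLegendreRegular (lift H)) {p v : ℝ × ℝ} (hv : 0 < v.1)
  (hslope : |v.2 / v.1| < D + 1) (hone : finslerOf A B L (projT p) v = 1)
include hH hv hslope hone

lemma fderiv_energy_fibre_finslerOf : fderiv ℝ (fun v => energy 𝓕 (p, v)) v =
    momentum (lift H) (p, v.2 / v.1) • ContinuousLinearMap.snd ℝ ℝ ℝ -
      lift H (p, momentum (lift H) (p, v.2 / v.1)) • ContinuousLinearMap.fst ℝ ℝ ℝ := by
  have hperspective : (fun v => energy 𝓕 (p, v)) =ᶠ[𝓝 v]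
      fun v => (1 / 2) * perspective (L (projT p)) v ^ 2 :=
    (finslerOf_eventuallyEq_of_pos (projT p) hv).mono fun u hu =>
      congrArg (fun r => (1 / 2) * r ^ 2) hu
  have hfibre : HasDerivAt (L (projT p)) _ (v.2 / v.1) :=
    hasDerivAt_fibre hL.differentiable_lift p (v.2 / v.1)
  have hderiv := ((hasFDerivAt_perspective hv.ne' hfibre).pow 2).const_mul (1 / 2 : ℝ)
  have hnorm : perspective (L (projT p)) v = 1 := (finslerOf_of_pos _ hv).symm.trans hone
  have hlegendre : L (projT p) (v.2 / v.1) = fibreLegendre (lift H) (p, v.2 / v.1) :=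
    hL.eq_fibreLegendre p _ hslope
  rw [hperspective.fderiv_eq]
  refine (hderiv.congr_fderiv ?_).fderiv
  rw [hnorm, hL.velocity_lift_of_abs_lt hH hslope, hlegendre, fibreLegendre]
  ext <;> simp
  ring

lemma fderiv_energy_base_finslerOf (w : ℝ × ℝ) : fderiv ℝ (fun x => energy 𝓕 (x, v)) p w =
    -(v.1 * fderiv ℝ (lift H) (p, momentum (lift H) (p, v.2 / v.1)) (w, 0)) := by
  have henergy : (fun x => energy 𝓕 (x, v)) =
      fun x => (1 / 2) * (v.1 * lift L (x, v.2 / v.1)) ^ 2 :=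
    funext fun x => congrArg (fun r => (1 / 2) * r ^ 2) (finslerOf_of_pos _ hv)
  have hbase : HasFDerivAt (fun x => lift L (x, v.2 / v.1)) _ p :=
    HasFDerivAt.comp (f := fun x => (x, v.2 / v.1)) p
      (hL.differentiable_lift (p, v.2 / v.1)).hasFDerivAt (hasFDerivAt_prodMk_left p _)
  have hnorm : v.1 * lift L (p, v.2 / v.1) = 1 := (finslerOf_of_pos _ hv).symm.trans hone
  rw [henergy, (((hbase.const_mul v.1).pow 2).const_mul (1 / 2 : ℝ)).fderiv, hnorm,
    hL.fderiv_lift_of_abs_lt hslope]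
  simp [hH.fderiv_fibreLegendre]

end Energy

lemma isGeodesic_of_mem_outerCone {c : ℝ → ℝ × ℝ} {v : ℝ × ℝ} (hv : v ∈ outerCone D)
    (hc : ∀ t, HasDerivAt c v t) : IsGeodesic 𝓕 c :=
  isEulerLagrange_of_hasDerivAt_const (Λ₀ := fun v => energy 𝓕 (0, v)) (isOpen_outerCone D)
    (fun _ x _ hu => congrArg (fun r => (1 / 2) * r ^ 2)
      (hL.finslerOf_eq_of_mem_outerCone (projT x) (projT 0) hu)) hv hc

lemma deriv_eq_of_mem_outerCone {c : ℝ → ℝ × ℝ} (hc : IsGeodesic 𝓕 c) {t₀ : ℝ}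
    (ht₀ : deriv c t₀ ∈ outerCone D) (t : ℝ) : deriv c t = deriv c t₀ := by
  have hne : ∀ v ∈ outerCone D, v ≠ 0 := by
    rintro v hv rfl
    simp [outerCone] at hv
  have hbase : ∀ (_ : ℝ) (x : ℝ × ℝ), ∀ v ∈ outerCone D, energy 𝓕 (x, v) = energy 𝓕 (0, v) :=
    fun _ x _ hv => congrArg (fun r => (1 / 2) * r ^ 2)
      (hL.finslerOf_eq_of_mem_outerCone (projT x) (projT 0) hv)
  have hsmooth : ContDiffOn ℝ 2 (fun v => energy 𝓕 (0, v)) (outerCone D) := fun v hv => by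
    have hfinsler : ContDiffAt ℝ ∞ (fun v => finslerOf A B L (projT 0) v) v :=
      (hL.contDiffAt_finslerOf (w := (0, v)) (hne v hv)).comp v
        (contDiffAt_const.prodMk contDiffAt_id)
    exact ((contDiffAt_const.mul (hfinsler.pow 2)).of_le (by norm_cast)).contDiffWithinAt
  have hconvex : ∀ v ∈ outerCone D, ∀ w, w ≠ 0 →
      0 < fderiv ℝ (fderiv ℝ fun v => energy 𝓕 (0, v)) v w w := fun v hv w hw =>
    hL.fderiv_fderiv_half_sq_finslerOf_pos (projT 0) (hne v hv) hw
  exact IsEulerLagrange.deriv_eq_of_mem hc (isOpen_outerCone D) hbase hsmooth hconvex ht₀ t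

variable (hH : IsConvexHamiltonian H D Dp Dm)
include hH

section IntegralCurve

variable {γ : ℝ → (ℝ × ℝ) × ℝ} (hγ : IsIntegralCurve γ fun _ => geodesicField H L)
include hγ

lemma isGeodesic_of_isIntegralCurve_of_abs_le (hle : ∀ t, |(γ t).2| ≤ D) :
    IsGeodesic 𝓕 (fun t => (γ t).1) := by
  have hreg := hH.isLegendreRegular_lift
  have hsmooth : ContDiff ℝ 2 γ := contDiff_two_of_isIntegralCurve
    ((hL.contDiff_geodesicField hH.contDiff_lift).of_le (by norm_cast)) hγ
  refine ⟨contDiff_fst.comp hsmooth, fun t => ?_⟩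
  set u : ℝ → ℝ := fun t => velocity (lift H) (γ t)
  set ℓ : ℝ → ℝ := fun t => lift L ((γ t).1, u t)
  have hℓ : ∀ t, 0 < ℓ t := fun t => hL.pos _ _
  have hvel : deriv (fun t => (γ t).1) = fun t => (ℓ t)⁻¹ • (1, u t) :=
    funext fun t => (hasDerivAt_position_of_isIntegralCurve hγ t).deriv
  have hpos : ∀ t, 0 < ((ℓ t)⁻¹ • ((1, u t) : ℝ × ℝ)).1 := fun t => by simpa using hℓ t
  have hslope : ∀ t, ((ℓ t)⁻¹ • ((1, u t) : ℝ × ℝ)).2 / ((ℓ t)⁻¹ • ((1, u t) : ℝ × ℝ)).1 = u t :=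
    fun t => snd_div_fst_smul_one (inv_pos.2 (hℓ t)).ne' (u t)
  have hlt : ∀ t, |((ℓ t)⁻¹ • ((1, u t) : ℝ × ℝ)).2 / ((ℓ t)⁻¹ • ((1, u t) : ℝ × ℝ)).1| < D + 1 :=
    fun t => by
      rw [hslope]
      exact (hH.abs_velocity_le_iff.2 (hle t)).trans_lt (lt_add_one D)
  have hone : ∀ t, 𝓕 (projT (γ t).1) ((ℓ t)⁻¹ • (1, u t)) = 1 := fun t =>
    finslerOf_inv_smul_one hL.pos _ _
  have hmom : ∀ t, momentum (lift H) ((γ t).1, u t) = (γ t).2 := fun t =>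
    hreg.momentum_velocity (γ t).1 (γ t).2
  have hgrad : ∀ s, fderiv ℝ (fun v => energy 𝓕 ((γ s).1, v)) ((ℓ s)⁻¹ • (1, u s)) =
      (γ s).2 • ContinuousLinearMap.snd ℝ ℝ ℝ - lift H (γ s) • ContinuousLinearMap.fst ℝ ℝ ℝ :=
    fun s => by
      rw [hL.fderiv_energy_fibre_finslerOf hreg (hpos s) (hlt s) (hone s), hslope, hmom]
  simp only [hvel, hgrad]
  refine (((hasDerivAt_momentum_of_isIntegralCurve hγ t).smul_const _).sub
    ((hasDerivAt_lift_of_isIntegralCurve hγ hH.differentiable_lift t).smul_const _)).congr_deriv ?_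
  ext
  all_goals
    rw [ContinuousLinearMap.comp_apply, ContinuousLinearMap.comp_apply,
      hL.fderiv_energy_base_finslerOf hreg (hpos t) (hlt t) (hone t), hslope, hmom]
    simp [ℓ, u]

lemma isGeodesic_of_isIntegralCurve : IsGeodesic 𝓕 (fun t => (γ t).1) := by
  by_cases hout : ∃ t₀, D < |(γ t₀).2|
  · obtain ⟨t₀, ht₀⟩ := hout
    have hmom := hH.momentum_eq_of_isIntegralCurve hγ ht₀
    have hmem : (L 0 (γ t₀).2)⁻¹ • ((1, (γ t₀).2) : ℝ × ℝ) ∈ outerCone D :=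
      (mem_outerCone_iff (by simpa using hL.pos _ _)).2 (by
        rwa [snd_div_fst_smul_one (inv_pos.2 (hL.pos _ _)).ne'])
    refine hL.isGeodesic_of_mem_outerCone hmem fun t => ?_
    have hfield := hL.geodesicField_of_lt_abs hH (γ t).1 ht₀
    rw [← hmom t, Prod.mk.eta] at hfield
    have hpos := (ContinuousLinearMap.fst ℝ (ℝ × ℝ) ℝ).hasFDerivAt.comp_hasDerivAt t (hγ t)
    exact hpos.congr_deriv (by simp [hfield, hmom t])
  · push Not at hout
    exact hL.isGeodesic_of_isIntegralCurve_of_abs_le hH hγ hout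

end IntegralCurve

lemma exists_isIntegralCurve_of_pos {p v : ℝ × ℝ} (hv : 0 < v.1)
    (hone : 𝓕 (projT p) v = 1) : ∃ γ, IsIntegralCurve γ (fun _ => geodesicField H L) ∧
      (γ 0).1 = p ∧ deriv (fun t => (γ t).1) 0 = v := by
  obtain ⟨γ, hγ₀, hγ⟩ :=
    hL.exists_isIntegralCurve_geodesicField hH (p, momentum (lift H) (p, v.2 / v.1))
  refine ⟨γ, hγ, by rw [hγ₀], ?_⟩
  rw [(hasDerivAt_position_of_isIntegralCurve hγ 0).deriv, hγ₀,
    hH.isLegendreRegular_lift.velocity_momentum]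
  exact (eq_inv_smul_one_of_finslerOf_eq_one hv hone).symm

lemma exists_isGeodesic {p v : ℝ × ℝ} (hone : 𝓕 (projT p) v = 1) :
    ∃ c, IsGeodesic 𝓕 c ∧ c 0 = p ∧ deriv c 0 = v := by
  rcases le_or_gt v.1 0 with hv | hv
  · have hout := mem_outerCone_of_nonpos hL.D_pos (hL.isFinsler_finslerOf.ne_zero_of_eq_one hone) hv
    have hline : ∀ t : ℝ, HasDerivAt (fun t : ℝ => p + t • v) v t := fun t => by
      simpa using ((hasDerivAt_id t).smul_const v).const_add p
    exact ⟨_, hL.isGeodesic_of_mem_outerCone hout hline, by simp, (hline 0).deriv⟩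
  · obtain ⟨γ, hγ, hp, hv⟩ := hL.exists_isIntegralCurve_of_pos hH hv hone
    exact ⟨_, hL.isGeodesic_of_isIntegralCurve hH hγ, hp, hv⟩

lemma isIntegralCurve_of_isGeodesic {c : ℝ → ℝ × ℝ} (hc : IsGeodesic 𝓕 c)
    (hone : 𝓕 (projT (c 0)) (deriv c 0) = 1) (hin : ∀ t, deriv c t ∉ outerCone D) :
    IsIntegralCurve (fun t => (c t, momentum (lift H) (c t, (deriv c t).2 / (deriv c t).1)))
      fun _ => geodesicField H L := by
  intro t
  have hF := hL.isFinsler_finslerOf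
  have hreg := hH.isLegendreRegular_lift
  have hunit : ∀ s, 𝓕 (projT (c s)) (deriv c s) = 1 := fun s => (hc.speed_eq hF s 0).trans hone
  have hpos : ∀ s, 0 < (deriv c s).1 := fun s =>
    pos_of_notMem_outerCone hL.D_pos (hF.ne_zero_of_eq_one (hunit s)) (hin s)
  have hlt : ∀ s, |(deriv c s).2 / (deriv c s).1| < D + 1 := fun s =>
    (not_lt.1 fun hs => hin s ((mem_outerCone_iff (hpos s)).2 hs)).trans_lt (lt_add_one D)
  have hEL := (hc.2 t).clm_apply (hasDerivAt_const t ((0, 1) : ℝ × ℝ))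
  simp only [hL.fderiv_energy_fibre_finslerOf hreg (hpos _) (hlt _) (hunit _)] at hEL
  simp only [sub_apply, smul_apply, ContinuousLinearMap.coe_fst', ContinuousLinearMap.coe_snd',
    smul_eq_mul, mul_one, mul_zero, sub_zero, map_zero, add_zero] at hEL
  rw [hL.fderiv_energy_base_finslerOf hreg (hpos t) (hlt t) (hunit t)] at hEL
  refine ((hc.hasDerivAt t).prodMk hEL).congr_deriv ?_
  have hvel : deriv c t = (lift L (c t, (deriv c t).2 / (deriv c t).1))⁻¹ •
      (1, (deriv c t).2 / (deriv c t).1) := eq_inv_smul_one_of_finslerOf_eq_one (hpos t) (hunit t)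
  have hinv : (deriv c t).1 = (lift L (c t, (deriv c t).2 / (deriv c t).1))⁻¹ := by
    simpa using congrArg Prod.fst hvel
  dsimp only
  rw [geodesicField, hreg.velocity_momentum, Prod.smul_mk, ← hvel, ← hinv, smul_eq_mul, mul_neg]

lemma isGeodesic_unique {c c' : ℝ → ℝ × ℝ} (hc : IsGeodesic 𝓕 c) (hc' : IsGeodesic 𝓕 c')
    (hone : 𝓕 (projT (c 0)) (deriv c 0) = 1) (h₀ : c 0 = c' 0) (hv₀ : deriv c 0 = deriv c' 0) :
    c = c' := by
  by_cases hout : deriv c 0 ∈ outerCone D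
  · refine integralCurve_unique (X := fun _ => deriv c 0) contDiff_const (fun t => ?_)
      (fun t => ?_) h₀
    · exact (hc.hasDerivAt t).congr_deriv (hL.deriv_eq_of_mem_outerCone hc hout t)
    · rw [hv₀] at hout ⊢
      exact (hc'.hasDerivAt t).congr_deriv (hL.deriv_eq_of_mem_outerCone hc' hout t)
  · have hin : ∀ {e : ℝ → ℝ × ℝ}, IsGeodesic 𝓕 e → deriv e 0 = deriv c 0 →
        ∀ t, deriv e t ∉ outerCone D := fun he he₀ t ht => hout (by
      rwa [← he₀, hL.deriv_eq_of_mem_outerCone he ht 0])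
    have heq := integralCurve_unique
      ((hL.contDiff_geodesicField hH.contDiff_lift).of_le (by norm_cast))
      (hL.isIntegralCurve_of_isGeodesic hH hc hone (hin hc rfl))
      (hL.isIntegralCurve_of_isGeodesic hH hc' (by rwa [← h₀, ← hv₀]) (hin hc' hv₀.symm))
      (by simp only [h₀, hv₀])
    exact funext fun t => congrArg Prod.fst (congrFun heq t)

lemma exists_geodesicFlow_finslerOf : ∃ φ, IsGeodesicFlow 𝓕 φ :=
  exists_geodesicFlow hL.isFinsler_finslerOf (fun _ _ => hL.exists_isGeodesic hH)
    fun _ _ hc hc' => hL.isGeodesic_unique hH hc hc'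

end IsTwistLagrangian

/-! ### The return map -/

/-- The unit tangent vector at the position of the point `q = ((t, x), y)` of the extended phase
space whose slope is the velocity of momentum `y`. -/
def toUnitTangent (H L : T2 → ℝ → ℝ) (q : (ℝ × ℝ) × ℝ) : TT2 :=
  projTT (q.1, (lift L (q.1, velocity (lift H) q))⁻¹ • (1, velocity (lift H) q))

section SpeedUp

variable {H L : T2 → ℝ → ℝ} {γ : ℝ → (ℝ × ℝ) × ℝ}
  (hγ : IsIntegralCurve γ fun _ => geodesicField H L)
include hγ

lemma hasDerivAt_time_of_isIntegralCurve (t : ℝ) : HasDerivAt (fun t => (γ t).1.1)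
    (lift L ((γ t).1, velocity (lift H) (γ t)))⁻¹ t :=
  ((ContinuousLinearMap.fst ℝ ℝ ℝ).hasFDerivAt.comp_hasDerivAt t
    (hasDerivAt_position_of_isIntegralCurve hγ t)).congr_deriv (mul_one _)

lemma strictMono_time_of_isIntegralCurve (hL : ∀ z v, 0 < L z v) :
    StrictMono fun t => (γ t).1.1 :=
  strictMono_of_deriv_pos fun t => by
    rw [(hasDerivAt_time_of_isIntegralCurve hγ t).deriv]
    exact inv_pos.2 (hL _ _)

-- `ṫ = 1 / L` stays away from `0`, so `t` takes every real value and can serve as the new time.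
lemma exists_isHamiltonSolution_of_isIntegralCurve (hH : Differentiable ℝ (lift H))
    (hL : ∀ z v, 0 < L z v) {M : ℝ} (hM : ∀ t, lift L ((γ t).1, velocity (lift H) (γ t)) ≤ M) :
    ∃ x y τ : ℝ → ℝ, IsHamiltonSolution H x y ∧ ∀ s, γ (τ s) = ((s, x s), y s) := by
  have hspeed : ∀ t, 0 < lift L ((γ t).1, velocity (lift H) (γ t)) := fun t => hL _ _
  obtain ⟨τ, hτ, hτ'⟩ := exists_inverse_of_forall_le_deriv
    (hasDerivAt_time_of_isIntegralCurve hγ) (inv_pos.2 ((hspeed 0).trans_le (hM 0)))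
    fun t => inv_anti₀ (hspeed t) (hM t)
  have hgraph : ∀ s, γ (τ s) = ((s, (γ (τ s)).1.2), (γ (τ s)).2) := fun s =>
    Prod.ext (Prod.ext (hτ s) rfl) rfl
  have hfield : ∀ s, HasDerivAt (γ ∘ τ)
      ((1, velocity (lift H) (γ (τ s))), -fderiv ℝ (lift H) (γ (τ s)) ((0, 1), 0)) s := fun s => by
    refine ((hγ (τ s)).scomp s (hτ' s)).congr_deriv ?_
    simp only [geodesicField, inv_inv, smul_smul, mul_inv_cancel₀ (hspeed _).ne', one_smul]
  refine ⟨fun s => (γ (τ s)).1.2, fun s => (γ (τ s)).2, τ,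
    (isHamiltonSolution_iff hH).2 fun s => ?_, hgraph⟩
  rw [← hgraph]
  have hbase := (ContinuousLinearMap.fst ℝ (ℝ × ℝ) ℝ).hasFDerivAt.comp_hasDerivAt s (hfield s)
  exact ⟨(ContinuousLinearMap.snd ℝ ℝ ℝ).hasFDerivAt.comp_hasDerivAt s hbase,
    (ContinuousLinearMap.snd ℝ (ℝ × ℝ) ℝ).hasFDerivAt.comp_hasDerivAt s (hfield s)⟩

end SpeedUp

section Legendre

variable {H L : T2 → ℝ → ℝ}

lemma slopeMap_toUnitTangent (hL : ∀ z v, 0 < L z v) (q : (ℝ × ℝ) × ℝ) :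
    slopeMap (toUnitTangent H L q) = projZ (q.1.2, velocity (lift H) q) :=
  Prod.ext rfl (snd_div_fst_smul_one (inv_pos.2 (hL _ _)).ne' _)

lemma toUnitTangent_mem_V0_iff {A B : ℝ} (hL : ∀ z v, 0 < L z v) {q : (ℝ × ℝ) × ℝ} :
    toUnitTangent H L q ∈ V0 (finslerOf A B L) ↔ ∃ n : ℤ, (n : ℝ) = q.1.1 := by
  rw [← coe_eq_zero_iff_exists_int]
  refine ⟨fun hq => hq.2.1, fun hq => ⟨finslerOf_inv_smul_one hL _ _, hq, ?_⟩⟩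
  have hpos : 0 < lift L (q.1, velocity (lift H) q) := hL _ _
  simpa [toUnitTangent, projTT] using hpos

lemma legendreZero_projZ (hH : Differentiable ℝ (lift H)) (n : ℤ) (x y : ℝ) :
    legendreZero H (projZ (x, y)) = projZ (x, velocity (lift H) ((n, x), y)) := by
  have hbase : projT (n, x) = (0, (x : S1)) :=
    Prod.ext (coe_eq_zero_iff_exists_int.2 ⟨n, rfl⟩) rfl
  have hfibre : HasDerivAt (H (projT (n, x))) _ y := hasDerivAt_fibre hH (n, x) y
  rw [← hfibre.deriv, hbase]
  rfl

end Legendre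

namespace IsTwistLagrangian

variable {H L : T2 → ℝ → ℝ} {D Dp Dm A B : ℝ} (hL : IsTwistLagrangian H L D A B)
  (hH : IsConvexHamiltonian H D Dp Dm)
include hL hH

local notation "𝓕" => finslerOf A B L

lemma exists_lift_le_of_isIntegralCurve {γ : ℝ → (ℝ × ℝ) × ℝ}
    (hγ : IsIntegralCurve γ fun _ => geodesicField H L) :
    ∃ M, ∀ t, lift L ((γ t).1, velocity (lift H) (γ t)) ≤ M := by
  by_cases hout : ∃ t₀, D < |(γ t₀).2|
  · obtain ⟨t₀, ht₀⟩ := hout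
    refine ⟨L 0 (γ t₀).2, fun t => ?_⟩
    have hmom := hH.momentum_eq_of_isIntegralCurve hγ ht₀ t
    have hvel : velocity (lift H) (γ t) = (γ t₀).2 :=
      hmom ▸ hH.velocity_of_lt_abs (γ t).1 (hmom ▸ ht₀)
    rw [hvel]
    exact (hL.eq_of_lt_abs _ 0 _ ht₀).le
  · push Not at hout
    have hbox : IsCompact (Icc (0 : ℝ × ℝ) 1 ×ˢ Icc (-D) D) := isCompact_Icc.prod isCompact_Icc
    obtain ⟨M, hM⟩ := hbox.bddAbove_image hL.smooth.continuous.continuousOn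
    refine ⟨M, fun t => ?_⟩
    obtain ⟨k, hk, hmem⟩ := exists_projT_eq_zero_add_mem_Icc (γ t).1
    have hslope : |velocity (lift H) (γ t)| ≤ D := hH.abs_velocity_le_iff.2 (hout t)
    rw [← lift_add_of_projT_eq_zero hk, Prod.mk_add_mk, add_zero]
    exact hM ⟨_, ⟨hmem, abs_le.1 hslope⟩, rfl⟩

lemma exists_isIntegralCurve_of_mem_V0 {u : TT2} (hu : u ∈ V0 𝓕) :
    ∃ γ, IsIntegralCurve γ (fun _ => geodesicField H L) ∧ (γ 0).1.1 = 0 ∧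
      toUnitTangent H L (γ 0) = u := by
  obtain ⟨⟨t, z⟩, v⟩ := u
  obtain ⟨hone, rfl, hv⟩ : 𝓕 (t, z) v = 1 ∧ t = 0 ∧ 0 < v.1 := hu
  obtain ⟨x, rfl⟩ := QuotientAddGroup.mk_surjective z
  obtain ⟨γ, hγ, hγ₀, hv₀⟩ := hL.exists_isIntegralCurve_of_pos hH (p := (0, x)) hv hone
  refine ⟨γ, hγ, congrArg Prod.fst hγ₀, ?_⟩
  rw [toUnitTangent, ← (hasDerivAt_position_of_isIntegralCurve hγ 0).deriv, hγ₀, hv₀]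
  rfl

lemma geodesicFlow_toUnitTangent {φ : ℝ → TT2 → TT2} (hφ : IsGeodesicFlow 𝓕 φ)
    {γ : ℝ → (ℝ × ℝ) × ℝ} (hγ : IsIntegralCurve γ fun _ => geodesicField H L) (t : ℝ) :
    φ t (toUnitTangent H L (γ 0)) = toUnitTangent H L (γ t) := by
  refine (((hφ.2 _ (finslerOf_inv_smul_one hL.pos _ _) fun t => toUnitTangent H L (γ t)).1
    ⟨⟨_, hL.isGeodesic_of_isIntegralCurve hH hγ, fun t => ?_⟩, rfl⟩) t).symm
  rw [(hasDerivAt_position_of_isIntegralCurve hγ t).deriv]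
  rfl

lemma exists_return {φ : ℝ → TT2 → TT2} (hφ : IsGeodesicFlow 𝓕 φ) {u : TT2} (hu : u ∈ V0 𝓕) :
    ∃ τ : ℝ, (0 < τ ∧ φ τ u ∈ V0 𝓕 ∧ ∀ t ∈ Ioo 0 τ, φ t u ∉ V0 𝓕) ∧
      ∃ x y : ℝ → ℝ, IsHamiltonSolution H x y ∧
        slopeMap u = legendreZero H (projZ (x 0, y 0)) ∧
        slopeMap (φ τ u) = legendreZero H (projZ (x 1, y 1)) := by
  obtain ⟨γ, hγ, hγ₀, rfl⟩ := hL.exists_isIntegralCurve_of_mem_V0 hH hu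
  obtain ⟨M, hM⟩ := hL.exists_lift_le_of_isIntegralCurve hH hγ
  obtain ⟨x, y, τ, hxy, hgraph⟩ :=
    exists_isHamiltonSolution_of_isIntegralCurve hγ hH.differentiable_lift hL.pos hM
  have hmono := strictMono_time_of_isIntegralCurve hγ hL.pos
  have htime : ∀ s, (γ (τ s)).1.1 = s := fun s => by rw [hgraph]
  have hτ₀ : τ 0 = 0 := hmono.injective ((htime 0).trans hγ₀.symm)
  have hτ₁ : 0 < τ 1 := hmono.lt_iff_lt.1 (by simp only [hγ₀, htime, zero_lt_one])
  refine ⟨τ 1, ⟨hτ₁, ?_, fun t ht hmem => ?_⟩, x, y, hxy, ?_, ?_⟩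
  · rw [hL.geodesicFlow_toUnitTangent hH hφ hγ, toUnitTangent_mem_V0_iff hL.pos]
    exact ⟨1, by rw [htime, Int.cast_one]⟩
  · rw [hL.geodesicFlow_toUnitTangent hH hφ hγ, toUnitTangent_mem_V0_iff hL.pos] at hmem
    obtain ⟨n, hn⟩ := hmem
    have hn₀ : (0 : ℝ) < n := by simpa only [hγ₀, ← hn] using hmono ht.1
    have hn₁ : (n : ℝ) < 1 := by simpa only [htime, ← hn] using hmono ht.2
    norm_cast at hn₀ hn₁
    omega
  · rw [slopeMap_toUnitTangent hL.pos, ← hτ₀, hgraph, hτ₀,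
      legendreZero_projZ hH.differentiable_lift 0, Int.cast_zero]
  · rw [hL.geodesicFlow_toUnitTangent hH hφ hγ, slopeMap_toUnitTangent hL.pos, hgraph,
      legendreZero_projZ hH.differentiable_lift 1, Int.cast_one]

end IsTwistLagrangian

/-! ### Conjugacy to the time-one maps -/

section SmoothMaps

variable {E₁ E₂ E₃ X Y Z : Type*} [NormedAddCommGroup E₁] [NormedSpace ℝ E₁]
  [NormedAddCommGroup E₂] [NormedSpace ℝ E₂] [NormedAddCommGroup E₃] [NormedSpace ℝ E₃]
  {pX : E₁ → X} {pY : E₂ → Y} {pZ : E₃ → Z} {f : X → Y} {g : Y → Z}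
  {S : Set X} {T : Set Y} {U : Set Z}

lemma IsSmoothOn.comp (hg : IsSmoothOn pY pZ g T) (hf : IsSmoothOn pX pY f S)
    (hST : MapsTo f S T) : IsSmoothOn pX pZ (g ∘ f) S := by
  intro e he
  obtain ⟨F, hF, hfF⟩ := hf e he
  have hmem : pY (F e) ∈ T := hfF.self_of_nhds he ▸ hST he
  obtain ⟨G, hG, hgG⟩ := hg (F e) hmem
  refine ⟨G ∘ F, hG.comp e hF, ?_⟩
  filter_upwards [hfF, hF.continuousAt.tendsto.eventually hgG] with w hfw hgw hw
  rw [Function.comp_apply, hfw hw]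
  exact hgw (hfw hw ▸ hST hw)

lemma IsDiffeoOn.comp (hg : IsDiffeoOn pY pZ g T U) (hf : IsDiffeoOn pX pY f S T) :
    IsDiffeoOn pX pZ (g ∘ f) S U := by
  obtain ⟨hg_bij, hg_smooth, g', hg', hg'_smooth⟩ := hg
  obtain ⟨hf_bij, hf_smooth, f', hf', hf'_smooth⟩ := hf
  have hmaps : MapsTo g' U T := hg'.1.mapsTo hg_bij.surjOn
  exact ⟨hg_bij.comp hf_bij, hg_smooth.comp hf_smooth hf_bij.mapsTo, f' ∘ g',
    hf'.comp hg' hf_bij.mapsTo hmaps, hf'_smooth.comp hg'_smooth hmaps⟩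

end SmoothMaps

section SlopeMap

/-- The inverse of `slopeMap`: the vector of the section `V₀` of the metric of `L` with given
position and slope. -/
def slopeMapInv (L : T2 → ℝ → ℝ) (z : Cyl) : TT2 :=
  ((0, z.1), (L (0, z.1) z.2)⁻¹ • (1, z.2))

variable {L : T2 → ℝ → ℝ} {A B : ℝ} (hL : ∀ z v, 0 < L z v)
include hL

lemma mapsTo_slopeMapInv : MapsTo (slopeMapInv L) univ (V0 (finslerOf A B L)) := fun z _ =>
  ⟨finslerOf_inv_smul_one hL _ _, rfl, by simpa [slopeMapInv] using hL (0, z.1) z.2⟩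

lemma invOn_slopeMapInv : InvOn (slopeMapInv L) slopeMap (V0 (finslerOf A B L)) univ := by
  refine ⟨?_, fun z _ => Prod.ext rfl (snd_div_fst_smul_one (inv_pos.2 (hL _ _)).ne' _)⟩
  rintro ⟨⟨_, x⟩, v⟩ ⟨hone : finslerOf A B L _ _ = 1, rfl, hv⟩
  exact Prod.ext rfl (eq_inv_smul_one_of_finslerOf_eq_one hv hone).symm

lemma isDiffeoOn_slopeMap (hL_smooth : ContDiff ℝ ∞ (lift L)) :
    IsDiffeoOn projTT projZ slopeMap (V0 (finslerOf A B L)) univ := by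
  refine ⟨(invOn_slopeMapInv hL).bijOn (mapsTo_univ _ _) (mapsTo_slopeMapInv hL), fun e he => ?_,
    slopeMapInv L, invOn_slopeMapInv hL, fun e _ => ?_⟩
  · have hv : e.2.1 ≠ 0 := he.2.2.ne'
    exact ⟨fun w => (w.1.2, w.2.2 / w.2.1), by fun_prop (disch := assumption),
      Eventually.of_forall fun w _ => rfl⟩
  · have hspeed : ContDiff ℝ ∞ fun q : ℝ × ℝ => (lift L ((0, q.1), q.2))⁻¹ :=
      (hL_smooth.comp (by fun_prop)).inv fun q => (hL _ _).ne'
    exact ⟨fun q => ((0, q.1), (lift L ((0, q.1), q.2))⁻¹ • (1, q.2)), by fun_prop,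
      Eventually.of_forall fun q _ => rfl⟩

end SlopeMap

section Legendre

/-- The inverse of `legendreZero H`, passing from velocity to momentum at time `0`. -/
def legendreZeroInv (H : T2 → ℝ → ℝ) (z : Cyl) : Cyl :=
  (z.1, Function.invFun (deriv (H (0, z.1))) z.2)

lemma projZ_surjective : Function.Surjective projZ :=
  QuotientAddGroup.mk_surjective.prodMap Function.surjective_id

variable {H : T2 → ℝ → ℝ} (hH : IsLegendreRegular (lift H))
include hH

lemma legendreZeroInv_projZ (x v : ℝ) :
    legendreZeroInv H (projZ (x, v)) = projZ (x, momentum (lift H) ((0, x), v)) := by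
  rw [momentum, ← deriv_fibre hH.differentiable]
  rfl

lemma legendreZero_legendreZeroInv (z : Cyl) : legendreZero H (legendreZeroInv H z) = z := by
  obtain ⟨⟨x, v⟩, rfl⟩ := projZ_surjective z
  rw [legendreZeroInv_projZ hH, legendreZero_projZ hH.differentiable 0, Int.cast_zero,
    hH.velocity_momentum]

lemma legendreZeroInv_legendreZero (z : Cyl) : legendreZeroInv H (legendreZero H z) = z := by
  obtain ⟨⟨x, y⟩, rfl⟩ := projZ_surjective z
  rw [legendreZero_projZ hH.differentiable 0, Int.cast_zero, legendreZeroInv_projZ hH,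
    hH.momentum_velocity]

lemma isDiffeoOn_legendreZeroInv : IsDiffeoOn projZ projZ (legendreZeroInv H) univ univ := by
  have hinv : InvOn (legendreZero H) (legendreZeroInv H) univ univ :=
    ⟨fun z _ => legendreZero_legendreZeroInv hH z, fun z _ => legendreZeroInv_legendreZero hH z⟩
  have hmomentum := hH.contDiff_momentum
  have hvelocity := contDiff_velocity hH.smooth
  refine ⟨hinv.bijOn (mapsTo_univ _ _) (mapsTo_univ _ _), fun e _ => ?_, legendreZero H, hinv,
    fun e _ => ?_⟩
  · exact ⟨fun q => (q.1, momentum (lift H) ((0, q.1), q.2)), by fun_prop,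
      Eventually.of_forall fun q _ => legendreZeroInv_projZ hH q.1 q.2⟩
  · exact ⟨fun q => (q.1, velocity (lift H) (((0 : ℤ), q.1), q.2)), by fun_prop,
      Eventually.of_forall fun q _ => legendreZero_projZ hH.differentiable 0 q.1 q.2⟩

end Legendre

lemma IsHamiltonSolution.projZ_deriv_position {H : T2 → ℝ → ℝ} (hH : ContDiff ℝ ∞ (lift H))
    {x y : ℝ → ℝ} (hxy : IsHamiltonSolution H x y) (n : ℤ) :
    projZ (x n, deriv x n) = legendreZero H (projZ (x n, y n)) := by
  rw [legendreZero_projZ (hH.differentiable (by simp)), hxy.deriv_position hH]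

lemma IsTwistLagrangian.isLagrangeTimeOneMap {H L : T2 → ℝ → ℝ} {D Dp Dm A B : ℝ}
    (hL : IsTwistLagrangian H L D A B) (hH : IsConvexHamiltonian H D Dp Dm) {f : Cyl → Cyl}
    (hf : IsHamiltonTimeOneMap H f) :
    IsLagrangeTimeOneMap L (legendreZero H ∘ f ∘ legendreZeroInv H) := by
  have hreg := hH.isLegendreRegular_lift
  have hends : ∀ {x y}, IsHamiltonSolution H x y →
      projZ (x 0, deriv x 0) = legendreZero H (projZ (x 0, y 0)) ∧
      projZ (x 1, deriv x 1) = legendreZero H (projZ (x 1, y 1)) := fun hxy =>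
    ⟨by simpa using hxy.projZ_deriv_position hreg.smooth 0,
      by simpa using hxy.projZ_deriv_position hreg.smooth 1⟩
  intro z w
  rw [Function.comp_apply, Function.comp_apply]
  constructor
  · rintro rfl
    obtain ⟨x, y, hxy, hstart, hend⟩ := (hf (legendreZeroInv H z) _).1 rfl
    refine ⟨x, (hL.isEulerLagrange_iff_exists_isHamiltonSolution hH).2 ⟨y, hxy⟩, ?_, ?_⟩
    · rw [(hends hxy).1, hstart, legendreZero_legendreZeroInv hreg]
    · rw [(hends hxy).2, hend]
  · rintro ⟨θ, hθ, rfl, rfl⟩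
    obtain ⟨y, hxy⟩ := (hL.isEulerLagrange_iff_exists_isHamiltonSolution hH).1 hθ
    rw [(hends hxy).1, (hends hxy).2, legendreZeroInv_legendreZero hreg]
    exact congrArg _ ((hf _ _).2 ⟨θ, y, hxy, rfl, rfl⟩)

end FinslerTwist

end

open FinslerTwist in
theorem mainTheorem2
    (H : T2 → ℝ → ℝ) (D Dp Dm : ℝ) (hD : 0 < D) (hH : IsConvexHamiltonian H D Dp Dm)
    (f : Cyl → Cyl) (hf : IsHamiltonTimeOneMap H f)
    (A B : ℝ) (hA : 0 < A) (hB : 0 < B) (hp hm : ℝ → ℝ)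
    (hp_smooth : ContDiff ℝ ∞ hp) (hm_smooth : ContDiff ℝ ∞ hm)
    (hp_convex : ∀ y, 0 < deriv (deriv hp) y) (hm_convex : ∀ y, 0 < deriv (deriv hm) y)
    (hp_inner : ∀ y, y < D + 1 → hp y = y ^ 2 / 2 - Dp)
    (hp_outer : ∀ y, D + 2 < y → hp y = Real.sqrt (A + B * y ^ 2))
    (hm_inner : ∀ y, -D - 1 < y → hm y = y ^ 2 / 2 - Dm)
    (hm_outer : ∀ y, y < -D - 2 → hm y = Real.sqrt (A + B * y ^ 2))
    (L : T2 → ℝ → ℝ) (hL : L = modifiedLagrangian H D hp hm)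
    (F : T2 → ℝ × ℝ → ℝ) (hF : F = finslerOf A B L) :
    IsFinsler F ∧
    ∃ (φ : ℝ → TT2 → TT2) (R : TT2 → TT2),
      IsGeodesicFlow F φ ∧ IsFirstReturnMap φ (V0 F) R ∧
      -- the explicit map `g` conjugates `R` to the time-one map of the Euler–Lagrange flow of `L`
      IsDiffeoOn projTT projZ slopeMap (V0 F) Set.univ ∧
      (∃ E : Cyl → Cyl, IsLagrangeTimeOneMap L E ∧
        ∀ u ∈ V0 F, slopeMap (R u) = E (slopeMap u)) ∧
      -- read in position-momentum coordinates, it conjugates `R` to `f`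
      ∃ Φ : TT2 → Cyl, IsDiffeoOn projTT projZ Φ (V0 F) Set.univ ∧
        (∀ u ∈ V0 F, legendreZero H (Φ u) = slopeMap u) ∧
        ∀ u ∈ V0 F, Φ (R u) = f (Φ u) := by
  subst hL hF
  have hL := isTwistLagrangian_modifiedLagrangian hD hH hp_inner hm_inner hA hB hp_smooth hm_smooth
    hp_convex hm_convex hp_outer hm_outer
  have hreg := hH.isLegendreRegular_lift
  have hslope := isDiffeoOn_slopeMap (A := A) (B := B) hL.pos hL.smooth
  obtain ⟨φ, hφ⟩ := hL.exists_geodesicFlow_finslerOf hH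
  choose! τ hτ x y hxy hstart hend using fun u hu => hL.exists_return hH hφ (u := u) hu
  refine ⟨hL.isFinsler_finslerOf, φ, fun u => φ (τ u) u, hφ,
    fun u hu => ⟨τ u, (hτ u hu).1, rfl, (hτ u hu).2⟩, hslope,
    ⟨_, hL.isLagrangeTimeOneMap hH hf, fun u hu => ?_⟩,
    legendreZeroInv H ∘ slopeMap, (isDiffeoOn_legendreZeroInv hreg).comp hslope,
    fun u _ => legendreZero_legendreZeroInv hreg _, fun u hu => ?_⟩
  all_goals
    have hone : f (projZ (x u 0, y u 0)) = projZ (x u 1, y u 1) :=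
      (hf _ _).2 ⟨x u, y u, hxy u hu, rfl, rfl⟩
    simp only [Function.comp_apply, hstart u hu, hend u hu, legendreZeroInv_legendreZero hreg, hone]
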